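/- Let $(E,d_E)$ be a complete separable metric space with its Borel $\sigma$-algebra, $p$ a Borel probability measure on $E$, and $X=E^{\mathbb N}$ with the metric $d(x,y)=\sum_{n\ge 1}2^{-n}\min\{d_E(x_n,y_n),1\}$. Let $0<\alpha<1$. For $\varphi:X\to\mathbb R$ put $D_\alpha(\varphi)=\sup_{x\ne y}|\varphi(x)-\varphi(y)|/d(x,y)^\alpha$, and let $\mathrm{Hol}(\alpha)$ be the space of bounded continuous $\varphi:X\to\mathbb R$ with $D_\alpha(\varphi)<\infty$, with norm $\|\varphi\|_\alpha=\|\varphi\|_\infty+D_\alpha(\varphi)$. Let $f\in\mathrm{Hol}(\alpha)$ and $$L_f\varphi(x)=\int_E e^{f(ax)}\varphi(ax)\,dp(a),\qquad ax=(a,x_1,x_2,\dots).$$ Then there are a Borel probability measure $\nu$ on $X$ and $\lambda>0$ with $\int L_f\varphi\,d\nu=\lambda\int\varphi\,d\nu$ for all bounded continuous $\varphi$, such that the limit $h(x)=\lim_{n\to\infty}L_f^n(1)(x)/\int L_f^n(1)\,d\nu$ exists for every $x\in X$. For all such $\nu,\lambda,h$ the following holds. 1. The formulas $Q(\varphi)=L_f(h\varphi)/(\lambda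 h)$ and $\Pi(\varphi)=\int\varphi h\,d\nu$ (a constant function) define bounded linear operators $Q,\Pi$ on $(\mathrm{Hol}(\alpha),\|\cdot\|_\alpha)$, and $\Pi Q=Q\Pi=\Pi$. 2. Call $s\in(0,1)$ a decay rate if for every $\psi\in\mathrm{Hol}(\alpha)$ with $\inf\psi>0$ there is $C>0$ such that for all $\varphi\in\mathrm{Hol}(\alpha)$ and all $n\ge 0$ $$D_\alpha\!\left(\frac{L_f^n\varphi}{L_f^n\psi}-\frac{\nu(\varphi)}{\nu(\psi)}\right)\le C s^n\left(D_\alpha(\varphi)+\left|\frac{\nu(\varphi)}{\nu(\psi)}\right|D_\alpha(\psi)\right)\|1/\psi\|_\infty,$$ where $\nu(\varphi)=\int\varphi\,d\nu$. Decay rates $s\in(0,1)$ exist, and for every decay rate $s\in(0,1)$ there is $C>0$ such that $\|(Q-\Pi)^n\|_\alpha\le C s^n$ (operator norm) for all $n\ge0$. 3. $\mathrm{Hol}(\alpha)=\mathbb R\oplus\ker\Pi$, where $\mathbb R$ denotes the constant functions; both summands are closed, both are invariant under $Q$ and under $\Pi$, and $Q|_{\mathbb R}=\Pi|_{\mathbb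 R}=\mathrm{id}$. -/

import Mathlib

open MeasureTheory Filter Topology
open scoped NNReal ENNReal BoundedContinuousFunction

noncomputable section

/-- The full one-sided shift space `X = E^ℕ`; the coordinates `x₁, x₂, …` are indexed from `0`. -/
def ShiftSpace (E : Type*) : Type _ := ℕ → E

namespace ShiftSpace

variable {E : Type*}

/-- The point `a x = (a, x₁, x₂, …)`. -/
def cons (a : E) (x : ShiftSpace E) : ShiftSpace E := fun n => Nat.casesOn n a x

section Metric

variable [MetricSpace E]

/-- `d_X(x, y) = ∑_{n ≥ 1} 2⁻ⁿ min(d_E(xₙ, yₙ), 1)`. -/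
instance : Dist (ShiftSpace E) :=
  ⟨fun x y => ∑' n : ℕ, (1 / 2 : ℝ) ^ (n + 1) * min (dist (x n) (y n)) 1⟩

theorem dist_def (x y : ShiftSpace E) :
    dist x y = ∑' n : ℕ, (1 / 2 : ℝ) ^ (n + 1) * min (dist (x n) (y n)) 1 := rfl

theorem summable_dist (x y : ShiftSpace E) :
    Summable fun n : ℕ => (1 / 2 : ℝ) ^ (n + 1) * min (dist (x n) (y n)) 1 := by
  refine Summable.of_nonneg_of_le (fun n => by positivity) (fun n => ?_)
    ((summable_nat_add_iff 1).2 summable_geometric_two)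
  exact mul_le_of_le_one_right (by positivity) (min_le_right _ _)

instance : MetricSpace (ShiftSpace E) where
  dist_self x := by simp [dist_def]
  dist_comm x y := by simp only [dist_def, dist_comm]
  dist_triangle x y z := by
    rw [dist_def x z, dist_def x y, dist_def y z,
      ← (summable_dist x y).tsum_add (summable_dist y z)]
    refine (summable_dist x z).tsum_le_tsum (fun n => ?_)
      ((summable_dist x y).add (summable_dist y z))
    rw [← mul_add]
    refine mul_le_mul_of_nonneg_left ?_ (by positivity)
    have h := dist_triangle (x n) (y n) (z n)
    have h1 : 0 ≤ dist (x n) (y n) := dist_nonneg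
    have h2 : 0 ≤ dist (y n) (z n) := dist_nonneg
    rcases le_total (dist (x n) (y n)) 1 with h3 | h3 <;>
    rcases le_total (dist (y n) (z n)) 1 with h4 | h4 <;>
    rcases le_total (dist (x n) (z n)) 1 with h5 | h5 <;>
    simp only [min_eq_left, min_eq_right, h3, h4, h5] <;> linarith
  eq_of_dist_eq_zero {x y} h := by
    funext n
    have h1 : (1 / 2 : ℝ) ^ (n + 1) * min (dist (x n) (y n)) 1 = 0 :=
      le_antisymm (h ▸ (summable_dist x y).le_tsum n (fun k _ => by positivity)) (by positivity)
    have h2 : (0 : ℝ) < (1 / 2) ^ (n + 1) := by positivity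
    have h3 : min (dist (x n) (y n)) 1 = 0 := by
      rcases mul_eq_zero.1 h1 with h4 | h4
      · exact absurd h4 h2.ne'
      · exact h4
    rcases le_total (dist (x n) (y n)) 1 with h4 | h4
    · rw [min_eq_left h4] at h3
      exact dist_eq_zero.1 h3
    · rw [min_eq_right h4] at h3
      exact absurd h3 one_ne_zero

/-- The Borel sigma-algebra of the metric `d_X`. -/
instance : MeasurableSpace (ShiftSpace E) := borel _

instance : BorelSpace (ShiftSpace E) := ⟨rfl⟩

end Metric

end ShiftSpace

section Holder

/-- The bounded continuous functions `φ : X → ℝ` with finite Hölder seminorm. Mathlib's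
`eHolderNorm α φ` (least `α`-Hölder constant, in `[0, ∞]`) is
`D_α(φ) = sup_{x ≠ y} |φ x - φ y| / d(x, y)^α`, and `MemHolder α φ` says that it is finite. -/
def holSubmodule (X : Type*) [MetricSpace X] (α : ℝ≥0) : Submodule ℝ (X →ᵇ ℝ) where
  carrier := {φ | MemHolder α φ}
  add_mem' hf hg := MemHolder.add hf hg
  zero_mem' := memHolder_zero
  smul_mem' _ _ hf := MemHolder.smul hf

/-- The space `Hol(α)`; it is a type of its own, because it carries the norm
`‖φ‖_α = ‖φ‖_∞ + D_α(φ)` and not the supremum norm. -/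
def Hol (X : Type*) [MetricSpace X] (α : ℝ≥0) : Type _ := holSubmodule X α

namespace Hol

variable {X : Type*} [MetricSpace X] {α : ℝ≥0}

instance : AddCommGroup (Hol X α) := inferInstanceAs (AddCommGroup (holSubmodule X α))

instance : Module ℝ (Hol X α) := inferInstanceAs (Module ℝ (holSubmodule X α))

/-- The underlying bounded continuous function. -/
def toBCF (φ : Hol X α) : X →ᵇ ℝ := φ.1

instance : CoeFun (Hol X α) (fun _ => X → ℝ) := ⟨fun φ => φ.toBCF⟩

theorem memHolder (φ : Hol X α) : MemHolder α (φ : X → ℝ) := φ.2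

/-- `‖φ‖_α = ‖φ‖_∞ + D_α(φ)`. -/
instance : Norm (Hol X α) := ⟨fun φ => ‖φ.toBCF‖ + nnHolderNorm α (φ : X → ℝ)⟩

theorem norm_def (φ : Hol X α) : ‖φ‖ = ‖φ.toBCF‖ + nnHolderNorm α (φ : X → ℝ) := rfl

theorem normCore : NormedSpace.Core ℝ (Hol X α) where
  norm_nonneg φ := by rw [norm_def]; positivity
  norm_smul c φ := by
    have h : nnHolderNorm α ((c • φ : Hol X α) : X → ℝ)
        = ‖c‖₊ * nnHolderNorm α (φ : X → ℝ) := φ.memHolder.nnHolderNorm_smul c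
    have h2 : ‖(c • φ).toBCF‖ = ‖c‖ * ‖φ.toBCF‖ := norm_smul c φ.toBCF
    rw [norm_def, norm_def, h, h2, NNReal.coe_mul, coe_nnnorm]
    ring
  norm_triangle φ ψ := by
    have h : nnHolderNorm α ((φ + ψ : Hol X α) : X → ℝ)
        ≤ nnHolderNorm α (φ : X → ℝ) + nnHolderNorm α (ψ : X → ℝ) :=
      φ.memHolder.nnHolderNorm_add_le ψ.memHolder
    have h2 : ‖(φ + ψ).toBCF‖ ≤ ‖φ.toBCF‖ + ‖ψ.toBCF‖ := norm_add_le φ.toBCF ψ.toBCF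
    have h3 : (nnHolderNorm α ((φ + ψ : Hol X α) : X → ℝ) : ℝ)
        ≤ nnHolderNorm α (φ : X → ℝ) + nnHolderNorm α (ψ : X → ℝ) := by exact_mod_cast h
    rw [norm_def, norm_def, norm_def]
    linarith
  norm_eq_zero_iff φ := by
    constructor
    · intro h
      rw [norm_def] at h
      have h1 : 0 ≤ ‖φ.toBCF‖ := norm_nonneg _
      have h2 : (0 : ℝ) ≤ nnHolderNorm α (φ : X → ℝ) := NNReal.coe_nonneg _
      exact Subtype.ext (norm_eq_zero.1 (le_antisymm (by linarith) h1) : φ.toBCF = 0)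
    · rintro rfl
      have h1 : (0 : Hol X α).toBCF = 0 := rfl
      rw [norm_def, h1]
      simp

instance : NormedAddCommGroup (Hol X α) := NormedAddCommGroup.ofCore normCore

instance : NormedSpace ℝ (Hol X α) := NormedSpace.ofCore normCore

/-- The constant functions, as a subspace of `Hol(α)`. -/
def constants (X : Type*) [MetricSpace X] (α : ℝ≥0) : Submodule ℝ (Hol X α) where
  carrier := {φ | ∃ c : ℝ, ∀ x, φ x = c}
  add_mem' := by
    rintro φ ψ ⟨a, ha⟩ ⟨b, hb⟩
    refine ⟨a + b, fun x => ?_⟩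
    rw [← ha x, ← hb x]
    rfl
  zero_mem' := ⟨0, fun _ => rfl⟩
  smul_mem' := by
    rintro c φ ⟨a, ha⟩
    refine ⟨c * a, fun x => ?_⟩
    rw [← ha x]
    rfl

end Hol

end Holder

section Ruelle

variable {E : Type*} [MetricSpace E] [MeasurableSpace E]

/-- The Ruelle operator `L_f φ (x) = ∫ exp(f(ax)) φ(ax) dp(a)` with a priori measure `p`. -/
def ruelle (p : Measure E) (f φ : ShiftSpace E → ℝ) : ShiftSpace E → ℝ :=
  fun x => ∫ a, Real.exp (f (ShiftSpace.cons a x)) * φ (ShiftSpace.cons a x) ∂p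

/-- The Perron-Frobenius-Ruelle data of `f`: a Borel probability measure `ν` with
`L_f^* ν = lam ν`, `lam > 0`, and the function `h = lim_n L_f^n(1) / ∫ L_f^n(1) dν`. -/
structure IsPFRData (p : Measure E) (f : ShiftSpace E → ℝ)
    (ν : Measure (ShiftSpace E)) (lam : ℝ) (h : ShiftSpace E → ℝ) : Prop where
  isProbabilityMeasure : IsProbabilityMeasure ν
  lam_pos : 0 < lam
  conformal : ∀ φ : ShiftSpace E →ᵇ ℝ, ∫ x, ruelle p f φ x ∂ν = lam * ∫ x, φ x ∂ν
  tendsto_h : ∀ x, Tendsto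
    (fun n : ℕ => (ruelle p f)^[n] 1 x / ∫ y, (ruelle p f)^[n] 1 y ∂ν) atTop (𝓝 (h x))

/-- `s` is a rate of the exponential decay of ratios of iterates of the Ruelle operator on
`Hol(α)`: for every `ψ ∈ Hol(α)` with `inf ψ > 0` there is `C > 0` such that, for all
`φ ∈ Hol(α)` and all `n`,
`D_α(L^n φ / L^n ψ - ν(φ)/ν(ψ)) ≤ C s^n (D_α(φ) + |ν(φ)/ν(ψ)| D_α(ψ)) ‖1/ψ‖_∞`. -/
def IsDecayRate (p : Measure E) (f : ShiftSpace E → ℝ) (ν : Measure (ShiftSpace E))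
    (α : ℝ≥0) (s : ℝ) : Prop :=
  ∀ ψ : Hol (ShiftSpace E) α, (∃ c : ℝ, 0 < c ∧ ∀ x, c ≤ ψ x) →
    ∃ C : ℝ, 0 < C ∧ ∀ (φ : Hol (ShiftSpace E) α) (n : ℕ),
      eHolderNorm α (fun x =>
          (ruelle p f)^[n] φ x / (ruelle p f)^[n] ψ x - (∫ y, φ y ∂ν) / ∫ y, ψ y ∂ν)
        ≤ ENNReal.ofReal (C * s ^ n *
            (nnHolderNorm α (φ : ShiftSpace E → ℝ)
              + |(∫ y, φ y ∂ν) / ∫ y, ψ y ∂ν| * nnHolderNorm α (ψ : ShiftSpace E → ℝ))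
            * ⨆ x, |1 / ψ x|)

end Ruelle

end

noncomputable section

/-! ### Hölder functions -/

section HolderBound

variable {X : Type*} [MetricSpace X]

/-! Everything rests on one coupling estimate. Put `θ = (1/2)^α` and let `f` have Hölder constant
`D`. If `(D + K) θ ≤ K`, the cone of positive functions whose logarithm is `α`-Hölder with constant
`K` is mapped into itself by `L`. For `w` in this cone, `L v x / L w x` is the average of `v / w`
over the preimages `a x`, with a probability density in `a`. The densities at `x` and `y` dominate
each other up to the factor `exp (-2 K t)`, `t = d(x, y)^α`. On that common part the two preimages
use the same letter `a` and `t` shrinks to `θ t`; on the rest only the total oscillation is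
available. The modulus `1 - exp (-A t)`, comparable to `t` because `X` has diameter at most 1, is
contracted by a factor `r < 1` (`exists_contracting_modulus`, `ruelleEnd_div_contraction`). Hence
the Hölder seminorm of `L^n v / L^n w` decays exponentially (`exists_ruelleEnd_pow_div_abs_sub_le`),
without compactness of `E`.

Existence of `ν`: normalized dual iterates of a Dirac mass are tight, since every coordinate becomes
a fresh `p`-distributed letter up to a bounded density. By the contraction, consecutive iterates
become indistinguishable on Hölder functions, so every limit point is conformal. Moreover `L^(n+1) 1
/ L^n 1` tends to `lam` uniformly and geometrically, which makes `lam⁻ⁿ L^n 1` converge.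

For arbitrary data `ν`, `lam`, `h`, conformality identifies `h` with `lim lam⁻ⁿ L^n 1`, a positive
Hölder eigenfunction of integral 1. Then `Q^n φ = L^n (h φ) / L^n h`, so a decay rate, used with `ψ
= h`, bounds the seminorm of `Q^n φ - Π φ`. This function has mean zero for `h dν`, so its
oscillation also bounds its supremum (`abs_sub_le_of_integral_mul_eq`). The algebra of the
projection `Π` gives `(Q - Π)^n = Q^n - Π` for `n ≥ 1` and the splitting. -/

theorem holderWith_iff_abs_sub_le {α C : ℝ≥0} {g : X → ℝ} :
    HolderWith C α g ↔ ∀ x y, |g x - g y| ≤ C * dist x y ^ (α : ℝ) := by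
  refine forall₂_congr fun x y => ?_
  have h : (C : ℝ≥0∞) * edist x y ^ (α : ℝ) = ENNReal.ofReal (C * dist x y ^ (α : ℝ)) := by
    rw [ENNReal.ofReal_mul C.coe_nonneg, ENNReal.ofReal_coe_nnreal, edist_dist,
      ENNReal.ofReal_rpow_of_nonneg dist_nonneg α.coe_nonneg]
  rw [h, edist_dist, Real.dist_eq, ENNReal.ofReal_le_ofReal_iff (by positivity)]

theorem holderWith_of_abs_sub_le {α : ℝ≥0} {C : ℝ} {g : X → ℝ}
    (h : ∀ x y, |g x - g y| ≤ C * dist x y ^ (α : ℝ)) : HolderWith C.toNNReal α g :=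
  holderWith_iff_abs_sub_le.2 fun x y => (h x y).trans
    (mul_le_mul_of_nonneg_right (Real.le_coe_toNNReal C) (by positivity))

theorem eHolderNorm_le_ofReal {α : ℝ≥0} {C : ℝ} {g : X → ℝ}
    (h : ∀ x y, |g x - g y| ≤ C * dist x y ^ (α : ℝ)) : eHolderNorm α g ≤ ENNReal.ofReal C :=
  (holderWith_of_abs_sub_le h).eHolderNorm_le

theorem nnHolderNorm_le_of_abs_sub_le {α : ℝ≥0} {C : ℝ} (hC : 0 ≤ C) {g : X → ℝ}
    (h : ∀ x y, |g x - g y| ≤ C * dist x y ^ (α : ℝ)) : (nnHolderNorm α g : ℝ) ≤ C := by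
  have h1 := (holderWith_of_abs_sub_le h).nnholderNorm_le
  rwa [← NNReal.coe_le_coe, Real.coe_toNNReal C hC] at h1

theorem abs_sub_le_of_eHolderNorm_le {α : ℝ≥0} {C : ℝ} (hC : 0 ≤ C) {g : X → ℝ}
    (h : eHolderNorm α g ≤ ENNReal.ofReal C) (x y : X) :
    |g x - g y| ≤ C * dist x y ^ (α : ℝ) := by
  have h1 : MemHolder α g := eHolderNorm_lt_top.1 (h.trans_lt ENNReal.ofReal_lt_top)
  refine (holderWith_iff_abs_sub_le.1 h1.holderWith x y).trans
    (mul_le_mul_of_nonneg_right ?_ (by positivity))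
  rw [← h1.coe_nnHolderNorm_eq_eHolderNorm] at h
  have h2 := ENNReal.toReal_mono ENNReal.ofReal_ne_top h
  rwa [ENNReal.toReal_ofReal hC, ENNReal.coe_toReal] at h2

namespace Hol

variable {α : ℝ≥0}

theorem abs_sub_le (φ : Hol X α) (x y : X) :
    |φ x - φ y| ≤ nnHolderNorm α (φ : X → ℝ) * dist x y ^ (α : ℝ) :=
  holderWith_iff_abs_sub_le.1 φ.memHolder.holderWith x y

theorem abs_le (φ : Hol X α) (x : X) : |φ x| ≤ ‖φ.toBCF‖ := φ.toBCF.norm_coe_le_norm x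

theorem norm_toBCF_le (φ : Hol X α) : ‖φ.toBCF‖ ≤ ‖φ‖ := by
  rw [norm_def]; exact le_add_of_nonneg_right (NNReal.coe_nonneg _)

theorem nnHolderNorm_le (φ : Hol X α) : (nnHolderNorm α (φ : X → ℝ) : ℝ) ≤ ‖φ‖ := by
  rw [norm_def]; exact le_add_of_nonneg_left (norm_nonneg _)

@[ext]
theorem ext {φ ψ : Hol X α} (h : ∀ x, φ x = ψ x) : φ = ψ :=
  Subtype.ext (BoundedContinuousFunction.ext h)

@[simp] theorem add_apply (φ ψ : Hol X α) (x : X) : (φ + ψ) x = φ x + ψ x := rfl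

@[simp] theorem sub_apply (φ ψ : Hol X α) (x : X) : (φ - ψ) x = φ x - ψ x := rfl

@[simp] theorem smul_apply (c : ℝ) (φ : Hol X α) (x : X) : (c • φ) x = c * φ x := rfl

/-- The element of `Hol(α)` given by a bounded function that satisfies a Hölder estimate. -/
def ofBounds (hα : 0 < α) (g : X → ℝ) (M D : ℝ) (hM : ∀ x, |g x| ≤ M)
    (hD : ∀ x y, |g x - g y| ≤ D * dist x y ^ (α : ℝ)) : Hol X α :=
  ⟨BoundedContinuousFunction.ofNormedAddCommGroup g
    ((holderWith_of_abs_sub_le hD).continuous hα) M hM, (holderWith_of_abs_sub_le hD).memHolder⟩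

@[simp] theorem ofBounds_apply (hα : 0 < α) (g : X → ℝ) (M D : ℝ) (hM : ∀ x, |g x| ≤ M)
    (hD : ∀ x y, |g x - g y| ≤ D * dist x y ^ (α : ℝ)) (x : X) :
    ofBounds hα g M D hM hD x = g x := rfl

theorem norm_le_of_bounds (φ : Hol X α) {M D : ℝ} (hM0 : 0 ≤ M) (hD0 : 0 ≤ D)
    (hM : ∀ x, |φ x| ≤ M) (hD : ∀ x y, |φ x - φ y| ≤ D * dist x y ^ (α : ℝ)) : ‖φ‖ ≤ M + D := by
  rw [norm_def]
  exact add_le_add ((BoundedContinuousFunction.norm_le hM0).2 hM)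
    (nnHolderNorm_le_of_abs_sub_le hD0 hD)

end Hol

end HolderBound

/-- A function whose average against a probability density vanishes is bounded by its
oscillation. -/
theorem abs_sub_le_of_integral_mul_eq {X : Type*} [MeasurableSpace X] {ν : Measure X} {g w : X → ℝ} {c B : ℝ}
    (hw : Integrable w ν) (hgw : Integrable (fun x => g x * w x) ν) (hw0 : ∀ x, 0 ≤ w x)
    (hw1 : 0 < ∫ x, w x ∂ν) (hc : ∫ x, g x * w x ∂ν = c * ∫ x, w x ∂ν)
    (hB : ∀ x y, |g x - g y| ≤ B) (x : X) : |g x - c| ≤ B := by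
  have key : ∀ y, |(g x - g y) * w y| ≤ B * w y := fun y => by
    rw [abs_mul, abs_of_nonneg (hw0 y)]
    exact mul_le_mul_of_nonneg_right (hB x y) (hw0 y)
  have h1 : ∫ y, (g x - g y) * w y ∂ν = (g x - c) * ∫ y, w y ∂ν := by
    simp_rw [sub_mul]
    rw [integral_sub (hw.const_mul _) hgw, integral_const_mul, hc]
  have h2 : |∫ y, (g x - g y) * w y ∂ν| ≤ ∫ y, B * w y ∂ν :=
    (abs_integral_le_integral_abs).trans
      (integral_mono_of_nonneg (ae_of_all _ fun y => abs_nonneg _) (hw.const_mul B)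
        (ae_of_all _ key))
  rw [h1, integral_const_mul, abs_mul, abs_of_pos hw1] at h2
  exact le_of_mul_le_mul_right h2 hw1

/-! ### The shift space -/

namespace ShiftSpace

variable {E : Type*}

@[simp] theorem cons_zero (a : E) (x : ShiftSpace E) : cons a x 0 = a := rfl

@[simp] theorem cons_succ (a : E) (x : ShiftSpace E) (n : ℕ) : cons a x (n + 1) = x n := rfl

variable [MetricSpace E]

theorem dist_cons_cons (a b : E) (x y : ShiftSpace E) :
    dist (cons a x) (cons b y) = (1 / 2) * min (dist a b) 1 + dist x y / 2 := by
  have h : dist x y / 2 = ∑' n : ℕ, (1 / 2 : ℝ) ^ (n + 1 + 1) * min (dist (x n) (y n)) 1 := by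
    rw [dist_def x y, ← tsum_div_const]
    refine tsum_congr fun n => ?_
    rw [pow_succ _ (n + 1)]
    ring
  rw [dist_def, (summable_dist _ _).tsum_eq_zero_add, h]
  simp

theorem dist_cons (a : E) (x y : ShiftSpace E) : dist (cons a x) (cons a y) = dist x y / 2 := by
  simp [dist_cons_cons]

/-- Diameter at most 1 is what lets a Hölder seminorm control the oscillation, and hence the
supremum of a function of mean zero. -/
theorem dist_le_one (x y : ShiftSpace E) : dist x y ≤ 1 := by
  have h : ∑' n : ℕ, (1 / 2 : ℝ) ^ (n + 1) = 1 := by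
    simp_rw [pow_succ]
    rw [tsum_mul_right, tsum_geometric_two]
    norm_num
  refine le_of_le_of_eq ((summable_dist x y).tsum_le_tsum
    (fun n => mul_le_of_le_one_right (by positivity) (min_le_right _ _))
    ((summable_nat_add_iff 1).2 summable_geometric_two)) h

theorem dist_rpow_le_one (x y : ShiftSpace E) (α : ℝ≥0) : dist x y ^ (α : ℝ) ≤ 1 :=
  Real.rpow_le_one dist_nonneg (dist_le_one x y) α.coe_nonneg

/-- The sole source of contraction in the dynamics: a common new letter multiplies `d^α` by `θ =
(1/2)^α < 1`. -/
theorem dist_cons_rpow (a : E) (x y : ShiftSpace E) (α : ℝ≥0) :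
    dist (cons a x) (cons a y) ^ (α : ℝ) = (1 / 2 : ℝ) ^ (α : ℝ) * dist x y ^ (α : ℝ) := by
  rw [dist_cons, div_eq_inv_mul, Real.mul_rpow (by norm_num) dist_nonneg, one_div]

theorem continuous_cons : Continuous fun q : E × ShiftSpace E => cons q.1 q.2 := by
  refine LipschitzWith.continuous (K := 1) (LipschitzWith.of_dist_le_mul fun q q' => ?_)
  rw [dist_cons_cons, Prod.dist_eq, NNReal.coe_one, one_mul]
  have h1 := min_le_left (dist q.1 q'.1) 1
  have h2 := le_max_left (dist q.1 q'.1) (dist q.2 q'.2)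
  have h3 := le_max_right (dist q.1 q'.1) (dist q.2 q'.2)
  linarith

theorem continuous_coord (i : ℕ) : Continuous fun x : ShiftSpace E => x i := by
  rw [Metric.continuous_iff]
  intro x ε hε
  refine ⟨(1 / 2) ^ (i + 1) * min ε 1, by positivity, fun y hy => ?_⟩
  have h1 : (1 / 2 : ℝ) ^ (i + 1) * min (dist (y i) (x i)) 1 ≤ dist y x :=
    (summable_dist y x).le_tsum i fun k _ => by positivity
  have h2 := lt_of_mul_lt_mul_left (h1.trans_lt hy) (by positivity)
  by_contra! h3
  exact absurd h2 (not_lt.2 (min_le_min_right 1 h3))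

/-- The identity from the product space to the shift space. -/
def ofPi (x : ℕ → E) : ShiftSpace E := x

/-- The distance to a fixed point is a uniformly convergent series of continuous functions on the
product. Only this direction is needed: it carries Tychonoff compactness of boxes over to the metric
of the shift space. -/
theorem continuous_ofPi : Continuous (ofPi : (ℕ → E) → ShiftSpace E) := by
  rw [continuous_iff_continuousAt]
  intro x
  rw [ContinuousAt, tendsto_iff_dist_tendsto_zero]
  have h : Continuous fun y : ℕ → E => ∑' n : ℕ, (1 / 2 : ℝ) ^ (n + 1) * min (dist (y n) (x n)) 1 := by
    refine continuous_tsum (u := fun n => (1 / 2 : ℝ) ^ (n + 1)) (fun n => by fun_prop)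
      ((summable_nat_add_iff 1).2 summable_geometric_two) fun n y => ?_
    rw [Real.norm_of_nonneg (by positivity)]
    exact mul_le_of_le_one_right (by positivity) (min_le_right _ _)
  have h1 := h.tendsto x
  rwa [show ∑' n : ℕ, (1 / 2 : ℝ) ^ (n + 1) * min (dist (x n) (x n)) 1 = 0 by simp] at h1

theorem isCompact_pi {K : ℕ → Set E} (hK : ∀ i, IsCompact (K i)) :
    IsCompact {x : ShiftSpace E | ∀ i, x i ∈ K i} := by
  have h := (isCompact_pi_infinite hK).image continuous_ofPi
  convert h using 1
  exact (Set.image_id' _).symm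

end ShiftSpace

/-! ### Elementary inequalities -/

/-- An explicit modulus `t ↦ 1 - exp (-A t)` that the one-step coupling contracts. -/
theorem exists_contracting_modulus {K θ : ℝ} (hK : 0 < K) (hθ0 : 0 < θ) (hθ1 : θ < 1) :
    ∃ A r : ℝ, 0 < A ∧ 0 < r ∧ r < 1 ∧ ∀ t : ℝ, 0 ≤ t → t ≤ 1 →
      Real.exp (-(2 * K * t)) * (1 - Real.exp (-(A * (θ * t)))) + (1 - Real.exp (-(2 * K * t)))
        ≤ r * (1 - Real.exp (-(A * t))) := by
  -- `A` is chosen so that `2 K + A θ = A b` with `b = (1 + θ) / 2 < 1`; the left side of the claim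
  -- then collapses to `1 - exp (-A b t)`.
  obtain ⟨A, hA⟩ : ∃ A, A = 4 * K / (1 - θ) := ⟨_, rfl⟩
  obtain ⟨b, hb⟩ : ∃ b, b = (1 + θ) / 2 := ⟨_, rfl⟩
  have hθ : 0 < 1 - θ := by linarith
  have hA0 : 0 < A := by rw [hA]; positivity
  have hb0 : 0 < b := by rw [hb]; positivity
  have hb1 : b < 1 := by rw [hb]; linarith
  have hAK : 2 * K + A * θ = A * b := by rw [hA, hb]; field_simp; ring
  have hAb : 0 < A * b := by positivity
  have hlt : Real.exp (-A) < Real.exp (-(A * b)) := by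
    rw [Real.exp_lt_exp]; nlinarith
  have hq : Real.exp (-(A * b)) < 1 := Real.exp_lt_one_iff.2 (by linarith)
  have hq' : Real.exp (-A) < 1 := Real.exp_lt_one_iff.2 (by linarith)
  -- `r` is the ratio of the two sides at `t = 1`; concavity shows that this is the worst case on
  -- `[0, 1]`.
  refine ⟨A, (1 - Real.exp (-(A * b))) / (1 - Real.exp (-A)), hA0,
    div_pos (by linarith) (by linarith), (div_lt_one (by linarith)).2 (by linarith),
    fun t ht0 ht1 => ?_⟩
  have h1 : Real.exp (-(2 * K * t)) * Real.exp (-(A * (θ * t))) = Real.exp (-(A * b) * t) := by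
    rw [← Real.exp_add, ← hAK]; congr 1; ring
  have h2 : Real.exp (-(2 * K * t)) * (1 - Real.exp (-(A * (θ * t)))) + (1 - Real.exp (-(2 * K * t)))
      = 1 - Real.exp (-(A * b) * t) := by rw [← h1]; ring
  rw [h2, div_mul_eq_mul_div, le_div_iff₀ (by linarith)]
  -- concavity of `q ↦ q ^ b` between `exp (-A)` and `1`
  set q₀ := Real.exp (-A)
  set q := Real.exp (-(A * t))
  have hqq : q₀ ≤ q := Real.exp_le_exp.2 (by nlinarith)
  have hq1 : q ≤ 1 := Real.exp_le_one_iff.2 (by nlinarith)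
  have hpow : ∀ s : ℝ, Real.exp (-(A * s)) ^ b = Real.exp (-(A * b) * s) := fun s => by
    rw [← Real.exp_mul]; congr 1; ring
  have ha : 0 ≤ (1 - q) / (1 - q₀) := div_nonneg (by linarith) (by linarith)
  have ha' : 0 ≤ (q - q₀) / (1 - q₀) := div_nonneg (by linarith) (by linarith)
  have hc := (Real.concaveOn_rpow hb0.le hb1.le).2
    (Set.mem_Ici.2 (Real.exp_pos (-A)).le) (Set.mem_Ici.2 zero_le_one) ha ha'
    (by rw [← add_div, div_eq_one_iff_eq (by linarith)]; ring)
  have hne : 1 - q₀ ≠ 0 := by linarith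
  have e1 : (1 - q) / (1 - q₀) * q₀ + (q - q₀) / (1 - q₀) * 1 = q := by field_simp; ring
  have e2 : q₀ ^ b = Real.exp (-(A * b)) := by
    have := hpow 1
    rwa [mul_one, mul_one] at this
  simp only [smul_eq_mul] at hc
  rw [e1, hpow t, Real.one_rpow, e2, div_mul_eq_mul_div, div_mul_eq_mul_div, ← add_div,
    div_le_iff₀ (by linarith)] at hc
  nlinarith

theorem one_sub_exp_neg_mul_le (A t : ℝ) : 1 - Real.exp (-(A * t)) ≤ A * t := by
  have := Real.add_one_le_exp (-(A * t))
  linarith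

/-- A chord of the convex exponential. With the preceding tangent bound, it makes the contracted
modulus comparable to `t` on `[0, 1]`. -/
theorem mul_le_one_sub_exp_neg_mul {A t : ℝ} (ht0 : 0 ≤ t) (ht1 : t ≤ 1) :
    (1 - Real.exp (-A)) * t ≤ 1 - Real.exp (-(A * t)) := by
  have h := convexOn_exp.2 (Set.mem_univ (-A)) (Set.mem_univ 0) ht0 (sub_nonneg.2 ht1) (by ring)
  simp only [smul_eq_mul, mul_zero, add_zero, Real.exp_zero, mul_one] at h
  rw [show t * -A = -(A * t) by ring] at h
  nlinarith

/-- Coupling estimate: if the density `γ₁` dominates `κ γ₂`, then the averages of `u₁` and `u₂`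
differ by at most `κ δ + (1 - κ) R`. -/
theorem integral_sub_integral_le_of_mul_le {Ω : Type*} [MeasurableSpace Ω] {p : Measure Ω}
    {γ₁ γ₂ u₁ u₂ : Ω → ℝ} {κ δ R : ℝ} (hκ : 0 ≤ κ)
    (h₁ : Integrable γ₁ p) (h₂ : Integrable γ₂ p)
    (h₁₁ : Integrable (fun a => γ₁ a * u₁ a) p) (h₂₂ : Integrable (fun a => γ₂ a * u₂ a) p)
    (h₂₁ : Integrable (fun a => γ₂ a * u₁ a) p)
    (i₁ : ∫ a, γ₁ a ∂p = 1) (i₂ : ∫ a, γ₂ a ∂p = 1) (hγ₂ : ∀ a, 0 ≤ γ₂ a)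
    (hγ : ∀ a, κ * γ₂ a ≤ γ₁ a) (hδ : ∀ a, u₁ a - u₂ a ≤ δ) (hR : ∀ a b, u₁ a - u₂ b ≤ R) :
    ∫ a, γ₁ a * u₁ a ∂p - ∫ a, γ₂ a * u₂ a ∂p ≤ κ * δ + (1 - κ) * R := by
  set c := ∫ a, γ₂ a * u₂ a ∂p with hc
  have hu₁ : ∀ a, u₁ a ≤ R + c := fun a => by
    have h : ∫ b, γ₂ b * u₁ a ∂p ≤ ∫ b, (γ₂ b * R + γ₂ b * u₂ b) ∂p :=
      integral_mono (h₂.mul_const _) ((h₂.mul_const _).add h₂₂) fun b => by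
        have := mul_le_mul_of_nonneg_left (hR a b) (hγ₂ b)
        simp only; linarith
    rwa [integral_add (h₂.mul_const _) h₂₂, integral_mul_const, integral_mul_const, i₂, one_mul,
      one_mul] at h
  have hA : ∫ a, γ₂ a * u₁ a ∂p ≤ δ + c := by
    have h : ∫ a, γ₂ a * u₁ a ∂p ≤ ∫ a, (γ₂ a * δ + γ₂ a * u₂ a) ∂p :=
      integral_mono h₂₁ ((h₂.mul_const _).add h₂₂) fun a => by
        have := mul_le_mul_of_nonneg_left (hδ a) (hγ₂ a)
        simp only; linarith
    rwa [integral_add (h₂.mul_const _) h₂₂, integral_mul_const, i₂, one_mul] at h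
  -- The excess `γ₁ - κ γ₂` is nonnegative of mass `1 - κ`, and on it `u₁` is at most `R + c`.
  have hB : ∫ a, (γ₁ a * u₁ a - κ * (γ₂ a * u₁ a)) ∂p
      ≤ ∫ a, (γ₁ a * (R + c) - κ * (γ₂ a * (R + c))) ∂p :=
    integral_mono (h₁₁.sub (h₂₁.const_mul κ))
      ((h₁.mul_const _).sub ((h₂.mul_const _).const_mul κ)) fun a => by
        have := mul_le_mul_of_nonneg_left (hu₁ a) (sub_nonneg.2 (hγ a))
        simp only; linarith
  rw [integral_sub h₁₁ (h₂₁.const_mul κ), integral_const_mul,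
    integral_sub (h₁.mul_const _) ((h₂.mul_const _).const_mul κ), integral_const_mul,
    integral_mul_const, integral_mul_const, i₁, i₂] at hB
  have := mul_le_mul_of_nonneg_left hA hκ
  linarith

end

noncomputable section

open ShiftSpace

variable {E : Type*} [MetricSpace E]

theorem continuous_cons_left (x : ShiftSpace E) : Continuous fun a : E => cons a x :=
  continuous_cons.comp (Continuous.prodMk_left x)

theorem continuous_cons_right (a : E) : Continuous fun x : ShiftSpace E => cons a x :=
  continuous_cons.comp (Continuous.prodMk_right a)

theorem abs_exp_mul_le (f φ : ShiftSpace E →ᵇ ℝ) (x : ShiftSpace E) :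
    |Real.exp (f x) * φ x| ≤ Real.exp ‖f‖ * ‖φ‖ := by
  rw [abs_mul, Real.abs_exp]
  exact mul_le_mul (Real.exp_le_exp.2 ((le_abs_self _).trans (f.norm_coe_le_norm x)))
    (φ.norm_coe_le_norm x) (abs_nonneg _) (Real.exp_pos _).le

/-! ### Functions with bounded distortion -/

/-- `w x ≤ exp (K d(x, y) ^ α) w y`, i.e. `log w` is Hölder when `w > 0`. -/
def LogHolder {X : Type*} [Dist X] (α : ℝ≥0) (K : ℝ) (w : X → ℝ) : Prop :=
  ∀ x y, w x ≤ Real.exp (K * dist x y ^ (α : ℝ)) * w y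

theorem LogHolder.one {X : Type*} [PseudoMetricSpace X] {α : ℝ≥0} {K : ℝ} (hK : 0 ≤ K) :
    LogHolder α K (1 : X → ℝ) := fun x y => by
  rw [Pi.one_apply, Pi.one_apply, mul_one, Real.one_le_exp_iff]
  positivity

theorem LogHolder.le_exp_mul {α : ℝ≥0} {K : ℝ} (hK : 0 ≤ K) {w : ShiftSpace E → ℝ}
    (hw : LogHolder α K w) (hw0 : ∀ x, 0 < w x) (x y : ShiftSpace E) :
    w x ≤ Real.exp K * w y :=
  (hw x y).trans (mul_le_mul_of_nonneg_right
    (Real.exp_le_exp.2 (mul_le_of_le_one_right hK (dist_rpow_le_one x y α))) (hw0 y).le)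

theorem LogHolder.abs_sub_le {α : ℝ≥0} {K M : ℝ} (hK : 0 ≤ K) {w : ShiftSpace E → ℝ}
    (hw : LogHolder α K w) (hw0 : ∀ x, 0 < w x) (hM : ∀ x, w x ≤ M) (x y : ShiftSpace E) :
    |w x - w y| ≤ M * Real.exp K * K * dist x y ^ (α : ℝ) := by
  have key : ∀ x y, w x - w y ≤ M * Real.exp K * K * dist x y ^ (α : ℝ) := fun x y => by
    set s := K * dist x y ^ (α : ℝ) with hs
    have hs0 : 0 ≤ s := by positivity
    have hsK : s ≤ K := mul_le_of_le_one_right hK (dist_rpow_le_one x y α)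
    have h1 : Real.exp s - 1 ≤ Real.exp K * s := by
      have h2 : 1 - s ≤ Real.exp (-s) := by have := Real.add_one_le_exp (-s); linarith
      have h3 := mul_le_mul_of_nonneg_left h2 (Real.exp_pos s).le
      rw [← Real.exp_add, add_neg_cancel, Real.exp_zero] at h3
      have h4 := mul_le_mul_of_nonneg_right (Real.exp_le_exp.2 hsK) hs0
      linarith
    have h5 : 0 ≤ Real.exp s - 1 := sub_nonneg.2 (Real.one_le_exp hs0)
    have h6 := hw x y
    rw [← hs] at h6
    calc w x - w y ≤ w y * (Real.exp s - 1) := by linarith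
      _ ≤ M * (Real.exp s - 1) := mul_le_mul_of_nonneg_right (hM y) h5
      _ ≤ M * (Real.exp K * s) := mul_le_mul_of_nonneg_left h1 ((hw0 y).le.trans (hM y))
      _ = M * Real.exp K * K * dist x y ^ (α : ℝ) := by rw [hs]; ring
  rw [abs_le']
  refine ⟨key x y, ?_⟩
  rw [neg_sub, dist_comm]
  exact key y x

/-- Passing from `a x` to `a y` costs at most `D θ t` in `f` and `K θ t` in `log w`, and `(D + K) θ
≤ K` absorbs the sum. Being pointwise in `a`, the bound serves both the invariance of the cone and
the comparison of the preimage densities. -/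
theorem exp_mul_cons_le {f : ShiftSpace E → ℝ} {α : ℝ≥0} {D K : ℝ}
    (hf : ∀ x y, |f x - f y| ≤ D * dist x y ^ (α : ℝ))
    (hK : (D + K) * (1 / 2 : ℝ) ^ (α : ℝ) ≤ K) {w : ShiftSpace E → ℝ} (hw : LogHolder α K w)
    (hw0 : ∀ x, 0 < w x) (a : E) (x y : ShiftSpace E) :
    Real.exp (f (cons a x)) * w (cons a x)
      ≤ Real.exp (K * dist x y ^ (α : ℝ)) * (Real.exp (f (cons a y)) * w (cons a y)) := by
  set t := dist x y ^ (α : ℝ) with ht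
  have ht0 : 0 ≤ t := by positivity
  have h1 := hw (cons a x) (cons a y)
  have h2 := (le_abs_self _).trans (hf (cons a x) (cons a y))
  rw [dist_cons_rpow, ← ht] at h1 h2
  calc Real.exp (f (cons a x)) * w (cons a x)
      ≤ Real.exp (f (cons a x)) * (Real.exp (K * ((1 / 2) ^ (α : ℝ) * t)) * w (cons a y)) :=
        mul_le_mul_of_nonneg_left h1 (Real.exp_pos _).le
    _ = Real.exp (f (cons a x) + K * ((1 / 2) ^ (α : ℝ) * t)) * w (cons a y) := by
        rw [Real.exp_add, mul_assoc]
    _ ≤ Real.exp (K * t + f (cons a y)) * w (cons a y) := by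
        refine mul_le_mul_of_nonneg_right (Real.exp_le_exp.2 ?_) (hw0 _).le
        have := mul_le_mul_of_nonneg_right hK ht0
        linarith
    _ = _ := by rw [Real.exp_add, mul_assoc]

/-! ### The Ruelle operator on bounded continuous functions -/

variable [MeasurableSpace E] [BorelSpace E]

variable (p : Measure E) [IsProbabilityMeasure p]

theorem integrable_exp_mul_cons (f φ : ShiftSpace E →ᵇ ℝ) (x : ShiftSpace E) :
    Integrable (fun a => Real.exp (f (cons a x)) * φ (cons a x)) p :=
  Integrable.of_bound (((f.continuous.comp (continuous_cons_left x)).rexp.mul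
      (φ.continuous.comp (continuous_cons_left x))).aestronglyMeasurable)
    (Real.exp ‖f‖ * ‖φ‖) (ae_of_all _ fun a => abs_exp_mul_le f φ (cons a x))

theorem continuous_ruelle (f φ : ShiftSpace E →ᵇ ℝ) : Continuous (ruelle p f φ) :=
  continuous_of_dominated (fun x => (integrable_exp_mul_cons p f φ x).aestronglyMeasurable)
    (fun x => ae_of_all _ fun a => abs_exp_mul_le f φ (cons a x)) (integrable_const _)
    (ae_of_all _ fun a => (f.continuous.comp (continuous_cons_right a)).rexp.mul
      (φ.continuous.comp (continuous_cons_right a)))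

omit [BorelSpace E] in
theorem abs_ruelle_le (f φ : ShiftSpace E →ᵇ ℝ) (x : ShiftSpace E) :
    |ruelle p f φ x| ≤ Real.exp ‖f‖ * ‖φ‖ := by
  have h := norm_integral_le_of_norm_le_const (μ := p)
    (f := fun a => Real.exp (f (cons a x)) * φ (cons a x))
    (ae_of_all _ fun a => abs_exp_mul_le f φ (cons a x))
  rwa [probReal_univ, mul_one] at h

/-- The Ruelle operator as a linear endomorphism of the bounded continuous functions. -/
def ruelleEnd (f : ShiftSpace E →ᵇ ℝ) : Module.End ℝ (ShiftSpace E →ᵇ ℝ) where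
  toFun φ := BoundedContinuousFunction.ofNormedAddCommGroup (ruelle p f φ)
    (continuous_ruelle p f φ) (Real.exp ‖f‖ * ‖φ‖) (abs_ruelle_le p f φ)
  map_add' φ ψ := by
    ext x
    have h := integral_add (integrable_exp_mul_cons p f φ x) (integrable_exp_mul_cons p f ψ x)
    simp only [← mul_add] at h
    exact h
  map_smul' c φ := by
    ext x
    have h := integral_const_mul (μ := p) c
      fun a => Real.exp (f (cons a x)) * φ (cons a x)
    simp only [mul_left_comm c] at h
    exact h

theorem ruelleEnd_apply (f φ : ShiftSpace E →ᵇ ℝ) (x : ShiftSpace E) :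
    ruelleEnd p f φ x = ∫ a, Real.exp (f (cons a x)) * φ (cons a x) ∂p := rfl

theorem coe_ruelleEnd (f φ : ShiftSpace E →ᵇ ℝ) : ⇑(ruelleEnd p f φ) = ruelle p f φ := rfl

theorem ruelleEnd_pow_succ (f φ : ShiftSpace E →ᵇ ℝ) (n : ℕ) :
    (ruelleEnd p f ^ (n + 1)) φ = ruelleEnd p f ((ruelleEnd p f ^ n) φ) := by
  rw [pow_succ']; rfl

theorem ruelleEnd_pow_succ' (f φ : ShiftSpace E →ᵇ ℝ) (n : ℕ) :
    (ruelleEnd p f ^ (n + 1)) φ = (ruelleEnd p f ^ n) (ruelleEnd p f φ) := by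
  rw [pow_succ]; rfl

theorem iterate_ruelle (f φ : ShiftSpace E →ᵇ ℝ) (n : ℕ) :
    (ruelle p f)^[n] φ = ⇑((ruelleEnd p f ^ n) φ) := by
  induction n with
  | zero => rfl
  | succ n ih => rw [Function.iterate_succ_apply', ih, ruelleEnd_pow_succ, coe_ruelleEnd]

theorem iterate_ruelle_one (f : ShiftSpace E →ᵇ ℝ) (n : ℕ) :
    (ruelle p f)^[n] 1 = ⇑((ruelleEnd p f ^ n) 1) :=
  iterate_ruelle p f 1 n

theorem ruelleEnd_mono (f : ShiftSpace E →ᵇ ℝ) {φ ψ : ShiftSpace E →ᵇ ℝ} (h : ∀ x, φ x ≤ ψ x)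
    (x : ShiftSpace E) : ruelleEnd p f φ x ≤ ruelleEnd p f ψ x :=
  integral_mono (integrable_exp_mul_cons p f φ x) (integrable_exp_mul_cons p f ψ x)
    fun _ => mul_le_mul_of_nonneg_left (h _) (Real.exp_pos _).le

theorem ruelleEnd_pow_mono (f : ShiftSpace E →ᵇ ℝ) {φ ψ : ShiftSpace E →ᵇ ℝ}
    (h : ∀ x, φ x ≤ ψ x) (n : ℕ) :
    ∀ x, (ruelleEnd p f ^ n) φ x ≤ (ruelleEnd p f ^ n) ψ x := by
  induction n with
  | zero => exact h
  | succ n ih =>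
    simp only [ruelleEnd_pow_succ]
    exact ruelleEnd_mono p f ih

theorem ruelleEnd_pos (f : ShiftSpace E →ᵇ ℝ) {w : ShiftSpace E →ᵇ ℝ} (hw : ∀ x, 0 < w x)
    (x : ShiftSpace E) : 0 < ruelleEnd p f w x := by
  have hpos : ∀ a, 0 < Real.exp (f (cons a x)) * w (cons a x) :=
    fun a => mul_pos (Real.exp_pos _) (hw _)
  rw [ruelleEnd_apply, integral_pos_iff_support_of_nonneg (fun a => (hpos a).le)
    (integrable_exp_mul_cons p f w x),
    show Function.support (fun a => Real.exp (f (cons a x)) * w (cons a x)) = Set.univ from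
      Set.eq_univ_of_forall fun _ => (hpos _).ne', measure_univ]
  exact one_pos

theorem ruelleEnd_pow_pos (f : ShiftSpace E →ᵇ ℝ) {w : ShiftSpace E →ᵇ ℝ} (hw : ∀ x, 0 < w x)
    (n : ℕ) : ∀ x, 0 < (ruelleEnd p f ^ n) w x := by
  induction n with
  | zero => exact hw
  | succ n ih =>
    simp only [ruelleEnd_pow_succ]
    exact ruelleEnd_pos p f ih

/-! ### Contraction of quotients by the Ruelle operator -/

section Contraction

variable {p} {f : ShiftSpace E →ᵇ ℝ} {α : ℝ≥0} {D K : ℝ}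

theorem LogHolder.ruelleEnd (hf : ∀ x y, |f x - f y| ≤ D * dist x y ^ (α : ℝ))
    (hK : (D + K) * (1 / 2 : ℝ) ^ (α : ℝ) ≤ K) {w : ShiftSpace E →ᵇ ℝ} (hw : LogHolder α K w)
    (hw0 : ∀ x, 0 < w x) : LogHolder α K (ruelleEnd p f w) := fun x y => by
  rw [ruelleEnd_apply, ruelleEnd_apply, ← integral_const_mul]
  exact integral_mono (integrable_exp_mul_cons p f w x)
    ((integrable_exp_mul_cons p f w y).const_mul _) fun a => exp_mul_cons_le hf hK hw hw0 a x y

theorem LogHolder.ruelleEnd_pow (hf : ∀ x y, |f x - f y| ≤ D * dist x y ^ (α : ℝ))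
    (hK : (D + K) * (1 / 2 : ℝ) ^ (α : ℝ) ≤ K) {w : ShiftSpace E →ᵇ ℝ} (hw : LogHolder α K w)
    (hw0 : ∀ x, 0 < w x) (n : ℕ) : LogHolder α K ((_root_.ruelleEnd p f ^ n) w) := by
  induction n with
  | zero => exact hw
  | succ n ih =>
    rw [ruelleEnd_pow_succ]
    exact ih.ruelleEnd hf hK (ruelleEnd_pow_pos p f hw0 n)

/-- One step of the Ruelle operator contracts the oscillation of the quotient `v / w`, measured
with the modulus `1 - exp (-A d(x, y) ^ α)`. -/
theorem ruelleEnd_div_contraction (hf : ∀ x y, |f x - f y| ≤ D * dist x y ^ (α : ℝ))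
    (hK : (D + K) * (1 / 2 : ℝ) ^ (α : ℝ) ≤ K) {A r B : ℝ} (hB : 0 ≤ B)
    (hAr : ∀ t : ℝ, 0 ≤ t → t ≤ 1 →
      Real.exp (-(2 * K * t)) * (1 - Real.exp (-(A * ((1 / 2 : ℝ) ^ (α : ℝ) * t))))
        + (1 - Real.exp (-(2 * K * t))) ≤ r * (1 - Real.exp (-(A * t))))
    {w v : ShiftSpace E →ᵇ ℝ} (hw : LogHolder α K w) (hw0 : ∀ x, 0 < w x)
    (h : ∀ x y, |v x / w x - v y / w y| ≤ B * (1 - Real.exp (-(A * dist x y ^ (α : ℝ)))))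
    (x y : ShiftSpace E) :
    |ruelleEnd p f v x / ruelleEnd p f w x - ruelleEnd p f v y / ruelleEnd p f w y|
      ≤ r * B * (1 - Real.exp (-(A * dist x y ^ (α : ℝ)))) := by
  have key : ∀ x y,
      ruelleEnd p f v x / ruelleEnd p f w x - ruelleEnd p f v y / ruelleEnd p f w y
        ≤ r * B * (1 - Real.exp (-(A * dist x y ^ (α : ℝ)))) := fun x y => by
    set t := dist x y ^ (α : ℝ) with ht
    have ht0 : 0 ≤ t := by positivity
    have ht1 : t ≤ 1 := dist_rpow_le_one x y α
    have hpos := ruelleEnd_pos p f hw0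
    -- `L v z / L w z` is the average of `u z` under the probability density `γ z`.
    let γ : ShiftSpace E → E → ℝ := fun z a =>
      Real.exp (f (cons a z)) * w (cons a z) / ruelleEnd p f w z
    let u : ShiftSpace E → E → ℝ := fun z a => v (cons a z) / w (cons a z)
    have hγu : ∀ z, (fun a => γ z a * u z a)
        = fun a => Real.exp (f (cons a z)) * v (cons a z) / ruelleEnd p f w z := fun z => by
      funext a
      have := (hw0 (cons a z)).ne'
      have := (hpos z).ne'
      simp only [γ, u]
      field_simp
    have hγ0 : ∀ z a, 0 ≤ γ z a := fun z a =>
      div_nonneg (mul_nonneg (Real.exp_pos _).le (hw0 _).le) (hpos z).le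
    have hγi : ∀ z, Integrable (γ z) p := fun z => (integrable_exp_mul_cons p f w z).div_const _
    have hγui : ∀ z, Integrable (fun a => γ z a * u z a) p := fun z => by
      rw [hγu]; exact (integrable_exp_mul_cons p f v z).div_const _
    have hγ1 : ∀ z, ∫ a, γ z a ∂p = 1 := fun z => by
      simp only [γ]
      rw [integral_div, ← ruelleEnd_apply, div_self (hpos z).ne']
    have hγu1 : ∀ z, ∫ a, γ z a * u z a ∂p = ruelleEnd p f v z / ruelleEnd p f w z := fun z => by
      rw [hγu, integral_div, ← ruelleEnd_apply]
    -- One factor `exp (K t)` comes from the integrand and one from the normalization `L w`, hence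
    -- `2 K t`.
    have hκ : ∀ a, Real.exp (-(2 * K * t)) * γ y a ≤ γ x a := fun a => by
      have h1 := exp_mul_cons_le hf hK hw hw0 a y x
      have h2 := hw.ruelleEnd (p := p) hf hK hw0 x y
      rw [dist_comm, ← ht] at h1
      rw [← ht] at h2
      have e : Real.exp (-(2 * K * t)) * (Real.exp (K * t) * Real.exp (K * t)) = 1 := by
        rw [← Real.exp_add, ← Real.exp_add, Real.exp_eq_one_iff]; ring
      simp only [γ]
      rw [← mul_div_assoc, div_le_div_iff₀ (hpos y) (hpos x)]
      calc _ ≤ Real.exp (-(2 * K * t)) * (Real.exp (K * t)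
            * (Real.exp (f (cons a x)) * w (cons a x)))
            * (Real.exp (K * t) * ruelleEnd p f w y) :=
            mul_le_mul (mul_le_mul_of_nonneg_left h1 (Real.exp_pos _).le) h2 (hpos x).le
              (mul_nonneg (Real.exp_pos _).le (mul_nonneg (Real.exp_pos _).le
                (mul_nonneg (Real.exp_pos _).le (hw0 _).le)))
        _ = (Real.exp (-(2 * K * t)) * (Real.exp (K * t) * Real.exp (K * t)))
            * (Real.exp (f (cons a x)) * w (cons a x) * ruelleEnd p f w y) := by ring
        _ = _ := by rw [e, one_mul]
    have hu : ∀ z z' a b, u z a - u z' b ≤ B := fun z z' a b =>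
      (le_abs_self _).trans ((h _ _).trans
        (mul_le_of_le_one_right hB (sub_le_self _ (Real.exp_pos _).le)))
    -- The mixed product pairs the density at `y` with the quotient at `x`; the quotient is bounded
    -- by its oscillation `B` plus its value at a reference letter.
    have hui : Integrable (fun a => γ y a * u x a) p := by
      have hc : Continuous (u x) := (v.continuous.comp (continuous_cons_left x)).div
        (w.continuous.comp (continuous_cons_left x)) fun a => (hw0 _).ne'
      obtain ⟨a₀⟩ : Nonempty E := nonempty_of_isProbabilityMeasure p
      refine (hγi y).mul_bdd (c := B + |u x a₀|) hc.aestronglyMeasurable (ae_of_all _ fun a => ?_)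
      rw [Real.norm_eq_abs, abs_le']
      have h1 := hu x x a a₀
      have h2 := hu x x a₀ a
      have h3 := le_abs_self (u x a₀)
      have h4 := neg_abs_le (u x a₀)
      constructor <;> linarith
    have main := integral_sub_integral_le_of_mul_le (κ := Real.exp (-(2 * K * t)))
      (δ := B * (1 - Real.exp (-(A * ((1 / 2 : ℝ) ^ (α : ℝ) * t))))) (R := B)
      (Real.exp_pos _).le (hγi x) (hγi y) (hγui x) (hγui y) hui (hγ1 x) (hγ1 y) (hγ0 y) hκ
      (fun a => by
        have h1 := (le_abs_self _).trans (h (cons a x) (cons a y))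
        rwa [dist_cons_rpow, ← ht] at h1)
      (fun a b => hu x y a b)
    rw [hγu1, hγu1] at main
    have := mul_le_mul_of_nonneg_left (hAr t ht0 ht1) hB
    linarith
  rw [abs_le']
  refine ⟨key x y, ?_⟩
  rw [neg_sub, dist_comm]
  exact key y x

theorem ruelleEnd_pow_div_contraction (hf : ∀ x y, |f x - f y| ≤ D * dist x y ^ (α : ℝ))
    (hK : (D + K) * (1 / 2 : ℝ) ^ (α : ℝ) ≤ K) {A r B : ℝ} (hB : 0 ≤ B) (hr : 0 ≤ r)
    (hAr : ∀ t : ℝ, 0 ≤ t → t ≤ 1 →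
      Real.exp (-(2 * K * t)) * (1 - Real.exp (-(A * ((1 / 2 : ℝ) ^ (α : ℝ) * t))))
        + (1 - Real.exp (-(2 * K * t))) ≤ r * (1 - Real.exp (-(A * t))))
    {w v : ShiftSpace E →ᵇ ℝ} (hw : LogHolder α K w) (hw0 : ∀ x, 0 < w x)
    (h : ∀ x y, |v x / w x - v y / w y| ≤ B * (1 - Real.exp (-(A * dist x y ^ (α : ℝ)))))
    (n : ℕ) (x y : ShiftSpace E) :
    |(ruelleEnd p f ^ n) v x / (ruelleEnd p f ^ n) w x
        - (ruelleEnd p f ^ n) v y / (ruelleEnd p f ^ n) w y|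
      ≤ r ^ n * B * (1 - Real.exp (-(A * dist x y ^ (α : ℝ)))) := by
  induction n generalizing x y with
  | zero => simpa using h x y
  | succ n ih =>
    simp only [ruelleEnd_pow_succ]
    have h1 := ruelleEnd_div_contraction (p := p) hf hK (by positivity) hAr
      (hw.ruelleEnd_pow (p := p) hf hK hw0 n) (ruelleEnd_pow_pos p f hw0 n) ih x y
    rwa [← mul_assoc, ← pow_succ'] at h1

variable (p) in
/-- Exponential contraction of the Hölder seminorm of quotients of iterates. -/
theorem exists_ruelleEnd_pow_div_abs_sub_le (hα : 0 < α)
    (hf : ∀ x y, |f x - f y| ≤ D * dist x y ^ (α : ℝ)) (hK0 : 0 < K)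
    (hK : (D + K) * (1 / 2 : ℝ) ^ (α : ℝ) ≤ K) :
    ∃ C r : ℝ, 0 < C ∧ 0 < r ∧ r < 1 ∧ ∀ w v : ShiftSpace E →ᵇ ℝ, LogHolder α K w →
      (∀ x, 0 < w x) → ∀ B : ℝ, 0 ≤ B →
      (∀ x y, |v x / w x - v y / w y| ≤ B * dist x y ^ (α : ℝ)) → ∀ n x y,
      |(ruelleEnd p f ^ n) v x / (ruelleEnd p f ^ n) w x
          - (ruelleEnd p f ^ n) v y / (ruelleEnd p f ^ n) w y|
        ≤ C * r ^ n * B * dist x y ^ (α : ℝ) := by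
  obtain ⟨A, r, hA, hr0, hr1, hAr⟩ := exists_contracting_modulus hK0
    (θ := (1 / 2 : ℝ) ^ (α : ℝ)) (by positivity)
    (Real.rpow_lt_one (by norm_num) (by norm_num) (NNReal.coe_pos.2 hα))
  have he : 0 < 1 - Real.exp (-A) := sub_pos.2 (Real.exp_lt_one_iff.2 (by linarith))
  -- The constant is the price of passing from `d^α` to the contracted modulus and back.
  refine ⟨A / (1 - Real.exp (-A)), r, by positivity, hr0, hr1,
    fun w v hw hw0 B hB h n x y => ?_⟩
  have h1 := ruelleEnd_pow_div_contraction (p := p) (B := B / (1 - Real.exp (-A))) hf hK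
    (by positivity) hr0.le hAr hw hw0 (fun x y => (h x y).trans ?_) n x y
  · refine h1.trans ?_
    have h2 := one_sub_exp_neg_mul_le A (dist x y ^ (α : ℝ))
    calc _ ≤ r ^ n * (B / (1 - Real.exp (-A))) * (A * dist x y ^ (α : ℝ)) :=
          mul_le_mul_of_nonneg_left h2 (by positivity)
      _ = _ := by ring
  · rw [div_mul_eq_mul_div, le_div_iff₀ he]
    have h2 := mul_le_one_sub_exp_neg_mul (A := A) (t := dist x y ^ (α : ℝ)) (by positivity)
      (dist_rpow_le_one x y α)
    have := mul_le_mul_of_nonneg_left h2 hB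
    linarith

end Contraction

/-- A distortion constant that the Ruelle operator of a Hölder potential preserves. -/
theorem exists_distortion_constant {D θ : ℝ} (hD : 0 ≤ D) (hθ0 : 0 < θ) (hθ1 : θ < 1) :
    ∃ K : ℝ, 0 < K ∧ (D + K) * θ ≤ K := by
  have h : 0 < 1 - θ := by linarith
  -- This solves `(D + 1 + K) θ = K`; the extra 1 keeps `K` positive when `D = 0`.
  refine ⟨(D + 1) * θ / (1 - θ), by positivity, ?_⟩
  rw [le_div_iff₀ h]
  have e : (D + (D + 1) * θ / (1 - θ)) * θ * (1 - θ) = (D * (1 - θ) + (D + 1) * θ) * θ := by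
    field_simp
  rw [e]
  nlinarith

end

noncomputable section

/-! ### The normalized eigenfunction -/

open ShiftSpace

variable {E : Type*} [MetricSpace E] [MeasurableSpace E] [BorelSpace E]

theorem bcf_smul_apply {X : Type*} [TopologicalSpace X] (c : ℝ) (φ : X →ᵇ ℝ) (x : X) :
    (c • φ) x = c * φ x := rfl

omit [MeasurableSpace E] [BorelSpace E] in
-- Values of `w` at any two points agree up to `exp K`; integrating this over either point compares
-- `w x` with the mean 1.
theorem LogHolder.bounds_of_integral_eq_one {α : ℝ≥0} {K : ℝ} (hK : 0 ≤ K)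
    {ν : Measure (ShiftSpace E)} [IsProbabilityMeasure ν] {w : ShiftSpace E →ᵇ ℝ}
    (hw : LogHolder α K w) (hw0 : ∀ x, 0 < w x) (h1 : ∫ x, w x ∂ν = 1) (x : ShiftSpace E) :
    Real.exp (-K) ≤ w x ∧ w x ≤ Real.exp K := by
  have hi := w.integrable ν
  have hle := hw.le_exp_mul hK hw0
  constructor
  · have h : ∫ y, w y ∂ν ≤ ∫ _, Real.exp K * w x ∂ν :=
      integral_mono hi (integrable_const _) fun y => hle y x
    rw [h1, integral_const, probReal_univ, one_smul] at h
    rw [Real.exp_neg, inv_le_iff_one_le_mul₀' (Real.exp_pos K)]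
    exact h
  · have h : ∫ _, w x ∂ν ≤ ∫ y, Real.exp K * w y ∂ν :=
      integral_mono (integrable_const _) (hi.const_mul _) fun y => hle x y
    rwa [integral_const_mul, h1, integral_const, probReal_univ, one_smul, mul_one] at h

theorem integral_ruelleEnd_pow {p : Measure E} [IsProbabilityMeasure p] {f : ShiftSpace E →ᵇ ℝ}
    {ν : Measure (ShiftSpace E)} {lam : ℝ}
    (hν : ∀ φ : ShiftSpace E →ᵇ ℝ, ∫ x, ruelle p f φ x ∂ν = lam * ∫ x, φ x ∂ν)
    (n : ℕ) (φ : ShiftSpace E →ᵇ ℝ) :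
    ∫ x, (ruelleEnd p f ^ n) φ x ∂ν = lam ^ n * ∫ x, φ x ∂ν := by
  induction n with
  | zero => simp
  | succ n ih => rw [ruelleEnd_pow_succ, coe_ruelleEnd, hν, ih, pow_succ']; ring

/-- `lam⁻ⁿ Lⁿ 1` is bounded above and below, uniformly in `n`. -/
theorem ruelleEnd_pow_one_div_bounds {p : Measure E} [IsProbabilityMeasure p]
    {f : ShiftSpace E →ᵇ ℝ} {ν : Measure (ShiftSpace E)} [IsProbabilityMeasure ν]
    {lam : ℝ} {α : ℝ≥0} {D K : ℝ} (hlam : 0 < lam)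
    (hν : ∀ φ : ShiftSpace E →ᵇ ℝ, ∫ x, ruelle p f φ x ∂ν = lam * ∫ x, φ x ∂ν)
    (hf : ∀ x y, |f x - f y| ≤ D * dist x y ^ (α : ℝ)) (hK0 : 0 ≤ K)
    (hK : (D + K) * (1 / 2 : ℝ) ^ (α : ℝ) ≤ K) (n : ℕ) (x : ShiftSpace E) :
    Real.exp (-K) ≤ (ruelleEnd p f ^ n) 1 x / lam ^ n
      ∧ (ruelleEnd p f ^ n) 1 x / lam ^ n ≤ Real.exp K := by
  have h1 : LogHolder α K (1 : ShiftSpace E →ᵇ ℝ) := LogHolder.one hK0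
  have h2 := h1.ruelleEnd_pow (p := p) hf hK (fun _ => one_pos) n
  have hl : 0 < (lam ^ n)⁻¹ := by positivity
  have h3 := LogHolder.bounds_of_integral_eq_one (ν := ν) (α := α) hK0
    (w := (lam ^ n)⁻¹ • (ruelleEnd p f ^ n) 1)
    (fun x y => by
      have := mul_le_mul_of_nonneg_left (h2 x y) hl.le
      rwa [mul_left_comm] at this)
    (fun x => mul_pos hl (ruelleEnd_pow_pos p f (fun _ => one_pos) n x))
    (by
      have h4 := integral_ruelleEnd_pow hν n 1
      simp only [BoundedContinuousFunction.coe_smul, smul_eq_mul]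
      rw [integral_const_mul, h4]
      simp [hlam.ne']) x
  rwa [div_eq_inv_mul]

/-- `H` is a positive Hölder eigenfunction of the Ruelle operator with bounded distortion,
normalized with respect to the conformal measure `ν`. -/
structure IsNormalizedEigenfunction (p : Measure E) [IsProbabilityMeasure p]
    (f : ShiftSpace E →ᵇ ℝ) (ν : Measure (ShiftSpace E)) (lam : ℝ) {α : ℝ≥0} (K : ℝ)
    (H : Hol (ShiftSpace E) α) : Prop where
  lam_pos : 0 < lam
  conformal : ∀ φ : ShiftSpace E →ᵇ ℝ, ∫ x, ruelle p f φ x ∂ν = lam * ∫ x, φ x ∂ν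
  logHolder : LogHolder α K H
  exp_neg_le : ∀ x, Real.exp (-K) ≤ H x
  le_exp : ∀ x, H x ≤ Real.exp K
  eigen : ruelleEnd p f H.toBCF = lam • H.toBCF
  integral_eq_one : ∫ x, H x ∂ν = 1

/-- Conformality gives `∫ L^n 1 dν = lam^n`, so `h` is the limit of `lam⁻ⁿ L^n 1`. Distortion and
two-sided bounds are uniform in `n` and survive pointwise limits; they also provide the domination
needed to pass the limit through `L` and through `∫ · dν`. -/
theorem IsPFRData.exists_isNormalizedEigenfunction {p : Measure E} [IsProbabilityMeasure p]
    {f : ShiftSpace E →ᵇ ℝ} {ν : Measure (ShiftSpace E)} {lam : ℝ} {h : ShiftSpace E → ℝ}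
    (hp : IsPFRData p f ν lam h) {α : ℝ≥0} (hα : 0 < α) {D K : ℝ}
    (hf : ∀ x y, |f x - f y| ≤ D * dist x y ^ (α : ℝ)) (hK0 : 0 ≤ K)
    (hK : (D + K) * (1 / 2 : ℝ) ^ (α : ℝ) ≤ K) :
    ∃ H : Hol (ShiftSpace E) α, (H : ShiftSpace E → ℝ) = h ∧
      IsNormalizedEigenfunction p f ν lam K H := by
  have := hp.isProbabilityMeasure
  have hlam := hp.lam_pos
  have hlim : ∀ x, Tendsto (fun n => (ruelleEnd p f ^ n) 1 x / lam ^ n) atTop (𝓝 (h x)) :=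
    fun x => by
    have h1 := hp.tendsto_h x
    simp_rw [iterate_ruelle_one, integral_ruelleEnd_pow hp.conformal] at h1
    simpa using h1
  have hb := ruelleEnd_pow_one_div_bounds hlam hp.conformal hf hK0 hK
  have hlow : ∀ x, Real.exp (-K) ≤ h x := fun x => ge_of_tendsto' (hlim x) fun n => (hb n x).1
  have hup : ∀ x, h x ≤ Real.exp K := fun x => le_of_tendsto' (hlim x) fun n => (hb n x).2
  have hpos : ∀ x, 0 < h x := fun x => (Real.exp_pos _).trans_le (hlow x)
  have hlog : LogHolder α K h := fun x y => by
    refine le_of_tendsto_of_tendsto' (hlim x) ((hlim y).const_mul _) fun n => ?_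
    have h1 : LogHolder α K (1 : ShiftSpace E →ᵇ ℝ) := LogHolder.one hK0
    have h2 := h1.ruelleEnd_pow (p := p) hf hK (fun _ => one_pos) n x y
    rw [← mul_div_assoc]
    exact div_le_div_of_nonneg_right h2 (by positivity)
  refine ⟨Hol.ofBounds hα h (Real.exp K) (Real.exp K * Real.exp K * K)
    (fun x => by rw [abs_of_pos (hpos x)]; exact hup x) (hlog.abs_sub_le hK0 hpos hup), rfl,
    hlam, hp.conformal, hlog, hlow, hup, ?_, ?_⟩
  · ext x
    have h1 : Tendsto (fun n => (ruelleEnd p f ^ (n + 1)) 1 x / lam ^ n) atTop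
        (𝓝 (lam * h x)) := by
      refine (((hlim x).comp (tendsto_add_atTop_nat 1)).const_mul lam).congr fun n => ?_
      simp only [Function.comp_apply]
      rw [pow_succ lam n]
      field_simp
    refine tendsto_nhds_unique (f := fun n => (ruelleEnd p f ^ (n + 1)) 1 x / lam ^ n) ?_ h1
    simp_rw [ruelleEnd_pow_succ, ruelleEnd_apply, ← integral_div, mul_div_assoc]
    refine tendsto_integral_of_dominated_convergence (fun _ => Real.exp ‖f‖ * Real.exp K)
      (fun n => ?_) (integrable_const _) (fun n => ae_of_all _ fun a => ?_)
      (ae_of_all _ fun a => (hlim (cons a x)).const_mul _)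
    · simp_rw [← mul_div_assoc]
      exact ((integrable_exp_mul_cons p f ((ruelleEnd p f ^ n) 1) x).div_const
        _).aestronglyMeasurable
    · rw [norm_mul, Real.norm_of_nonneg (Real.exp_pos _).le,
        Real.norm_of_nonneg ((Real.exp_pos _).le.trans (hb n _).1)]
      exact mul_le_mul (Real.exp_le_exp.2 ((le_abs_self _).trans (f.norm_coe_le_norm _)))
        (hb n _).2 ((Real.exp_pos _).le.trans (hb n _).1) (Real.exp_pos _).le
  · refine tendsto_nhds_unique (tendsto_integral_of_dominated_convergence
      (F := fun n x => (ruelleEnd p f ^ n) 1 x / lam ^ n) (fun _ => Real.exp K)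
      (fun n => ((((ruelleEnd p f ^ n) 1).integrable ν).div_const _).aestronglyMeasurable)
      (integrable_const _) (fun n => ae_of_all _ fun x => ?_)
      (ae_of_all _ hlim)) ?_
    · rw [Real.norm_of_nonneg ((Real.exp_pos _).le.trans (hb n x).1)]
      exact (hb n x).2
    · refine tendsto_const_nhds.congr fun n => ?_
      rw [integral_div, integral_ruelleEnd_pow hp.conformal]
      simp [hlam.ne']

/-! ### The normalized operator and the projection -/

namespace IsNormalizedEigenfunction

variable {p : Measure E} [IsProbabilityMeasure p] {f : ShiftSpace E →ᵇ ℝ}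
  {ν : Measure (ShiftSpace E)} {lam : ℝ} {α : ℝ≥0} {K : ℝ} {H : Hol (ShiftSpace E) α}

theorem pos (hH : IsNormalizedEigenfunction p f ν lam K H) (x : ShiftSpace E) : 0 < H x :=
  (Real.exp_pos _).trans_le (hH.exp_neg_le x)

theorem ruelleEnd_pow_eigen (hH : IsNormalizedEigenfunction p f ν lam K H) (n : ℕ) :
    (ruelleEnd p f ^ n) H.toBCF = lam ^ n • H.toBCF := by
  induction n with
  | zero => simp
  | succ n ih => rw [ruelleEnd_pow_succ, ih, map_smul, hH.eigen, smul_smul, pow_succ]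

theorem ruelleEnd_pow_eigen_apply (hH : IsNormalizedEigenfunction p f ν lam K H) (n : ℕ)
    (x : ShiftSpace E) : (ruelleEnd p f ^ n) H.toBCF x = lam ^ n * H x := by
  rw [hH.ruelleEnd_pow_eigen]; rfl

theorem ruelleEnd_eigen_apply (hH : IsNormalizedEigenfunction p f ν lam K H)
    (x : ShiftSpace E) : ruelleEnd p f H.toBCF x = lam * H x := by
  rw [hH.eigen]; rfl

/-- `H φ` lies between `-‖φ‖ H` and `‖φ‖ H`, and `L` is monotone with `L H = lam H`. -/
theorem abs_ruelleEnd_mul_div_le (hH : IsNormalizedEigenfunction p f ν lam K H)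
    (φ : ShiftSpace E →ᵇ ℝ) (x : ShiftSpace E) :
    |ruelleEnd p f (H.toBCF * φ) x / (lam * H x)| ≤ ‖φ‖ := by
  have hpos : 0 < lam * H x := mul_pos hH.lam_pos (hH.pos x)
  have hφ : ∀ y, |φ y| ≤ ‖φ‖ := φ.norm_coe_le_norm
  have key : ∀ c : ℝ, ruelleEnd p f (c • H.toBCF) x = c * (lam * H x) := fun c => by
    rw [map_smul, bcf_smul_apply, hH.ruelleEnd_eigen_apply]
  rw [abs_div, abs_of_pos hpos, div_le_iff₀ hpos, abs_le, ← neg_mul, ← key, ← key]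
  constructor <;> refine ruelleEnd_mono p f (fun y => ?_) x
  · have := mul_le_mul_of_nonneg_left (abs_le.1 (hφ y)).1 (hH.pos y).le
    simpa [mul_comm] using this
  · have := mul_le_mul_of_nonneg_left (abs_le.1 (hφ y)).2 (hH.pos y).le
    simpa [mul_comm] using this

/-- The operator `Q φ = L (H φ) / (lam H)` is bounded on `Hol(α)`. -/
theorem exists_normalizedOperator (hH : IsNormalizedEigenfunction p f ν lam K H) (hα : 0 < α)
    {D : ℝ} (hf : ∀ x y, |f x - f y| ≤ D * dist x y ^ (α : ℝ)) (hK0 : 0 < K)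
    (hK : (D + K) * (1 / 2 : ℝ) ^ (α : ℝ) ≤ K) :
    ∃ Q : Hol (ShiftSpace E) α →L[ℝ] Hol (ShiftSpace E) α,
      ∀ φ x, Q φ x = ruelleEnd p f (H.toBCF * φ.toBCF) x / (lam * H x) := by
  obtain ⟨C, r, hC, hr0, hr1, hCr⟩ := exists_ruelleEnd_pow_div_abs_sub_le p hα hf hK0 hK
  have hD : ∀ (φ : Hol (ShiftSpace E) α) x y,
      |ruelleEnd p f (H.toBCF * φ.toBCF) x / (lam * H x)
        - ruelleEnd p f (H.toBCF * φ.toBCF) y / (lam * H y)|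
        ≤ C * r * nnHolderNorm α (φ : ShiftSpace E → ℝ) * dist x y ^ (α : ℝ) := fun φ x y => by
    -- The contraction is used with `w = H`, `v = H φ` and `n = 1`, so that `v / w = φ`.
    have h := hCr H.toBCF (H.toBCF * φ.toBCF) hH.logHolder hH.pos
      (nnHolderNorm α (φ : ShiftSpace E → ℝ)) (NNReal.coe_nonneg _)
      (fun x y => ?_) 1 x y
    · simp only [pow_one, hH.ruelleEnd_eigen_apply] at h
      exact h
    · simp only [BoundedContinuousFunction.coe_mul, Pi.mul_apply,
        mul_div_cancel_left₀ _ (hH.pos _).ne']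
      exact φ.abs_sub_le x y
  refine ⟨LinearMap.mkContinuous
    { toFun := fun φ => Hol.ofBounds hα
        (fun x => ruelleEnd p f (H.toBCF * φ.toBCF) x / (lam * H x)) _ _
        (hH.abs_ruelleEnd_mul_div_le φ.toBCF) (hD φ)
      map_add' := fun φ ψ => ?_
      map_smul' := fun c φ => ?_ } (1 + C * r) fun φ => ?_, fun φ x => rfl⟩
  · ext x
    simp only [Hol.ofBounds_apply, Hol.add_apply]
    rw [show (φ + ψ).toBCF = φ.toBCF + ψ.toBCF from rfl, mul_add, map_add,
      BoundedContinuousFunction.add_apply, add_div]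
  · ext x
    simp only [Hol.ofBounds_apply, Hol.smul_apply, RingHom.id_apply]
    rw [show (c • φ).toBCF = c • φ.toBCF from rfl, mul_smul_comm, map_smul,
      bcf_smul_apply, mul_div_assoc]
  · refine (Hol.norm_le_of_bounds _ (norm_nonneg _) (by positivity)
      (hH.abs_ruelleEnd_mul_div_le φ.toBCF) (hD φ)).trans ?_
    rw [add_mul, one_mul]
    exact add_le_add φ.norm_toBCF_le
      (mul_le_mul_of_nonneg_left φ.nnHolderNorm_le (by positivity))

/-- `Q` is `lam⁻¹ L` conjugated by multiplication by `H`, so the intermediate factors `H` cancel. -/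
theorem normalizedOperator_pow_apply (hH : IsNormalizedEigenfunction p f ν lam K H)
    {Q : Hol (ShiftSpace E) α →L[ℝ] Hol (ShiftSpace E) α}
    (hQ : ∀ φ x, Q φ x = ruelleEnd p f (H.toBCF * φ.toBCF) x / (lam * H x))
    (n : ℕ) (φ : Hol (ShiftSpace E) α) (x : ShiftSpace E) :
    (Q ^ n) φ x = (ruelleEnd p f ^ n) (H.toBCF * φ.toBCF) x / (lam ^ n * H x) := by
  have hlam := hH.lam_pos
  induction n generalizing x with
  | zero => simp [mul_div_cancel_left₀ _ (hH.pos x).ne']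
  | succ n ih =>
    have h1 : H.toBCF * ((Q ^ n) φ).toBCF
        = (lam ^ n)⁻¹ • (ruelleEnd p f ^ n) (H.toBCF * φ.toBCF) := by
      ext y
      have := (hH.pos y).ne'
      simp only [BoundedContinuousFunction.coe_mul, Pi.mul_apply, ih y,
        BoundedContinuousFunction.coe_smul, smul_eq_mul]
      field_simp
    have := (hH.pos x).ne'
    rw [pow_succ', mul_apply_eq_comp, hQ, h1, map_smul, ruelleEnd_pow_succ,
      bcf_smul_apply, pow_succ lam n]
    field_simp

theorem abs_integral_mul_le (hH : IsNormalizedEigenfunction p f ν lam K H)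
    [IsProbabilityMeasure ν] (φ : ShiftSpace E →ᵇ ℝ) : |∫ y, φ y * H y ∂ν| ≤ ‖φ‖ := by
  have h : |∫ y, φ y * H y ∂ν| ≤ ∫ y, ‖φ‖ * H y ∂ν :=
    abs_integral_le_integral_abs.trans (integral_mono_of_nonneg
      (ae_of_all _ fun y => abs_nonneg _) ((H.toBCF.integrable ν).const_mul _)
      (ae_of_all _ fun y => by
        simp only [abs_mul, abs_of_pos (hH.pos y)]
        exact mul_le_mul_of_nonneg_right (φ.norm_coe_le_norm y) (hH.pos y).le))
  rwa [integral_const_mul, hH.integral_eq_one, mul_one] at h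

/-- The projection `Π φ = ∫ φ H dν` onto the constants is bounded on `Hol(α)`. -/
theorem exists_projection (hH : IsNormalizedEigenfunction p f ν lam K H)
    [IsProbabilityMeasure ν] (hα : 0 < α) :
    ∃ P : Hol (ShiftSpace E) α →L[ℝ] Hol (ShiftSpace E) α,
      ∀ φ x, P φ x = ∫ y, φ y * H y ∂ν := by
  have hD : ∀ c : ℝ, ∀ x y : ShiftSpace E, |c - c| ≤ 0 * dist x y ^ (α : ℝ) := by simp
  have hi : ∀ φ : Hol (ShiftSpace E) α, Integrable (fun y => φ y * H y) ν := fun φ =>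
    (φ.toBCF * H.toBCF).integrable ν
  refine ⟨LinearMap.mkContinuous
    { toFun := fun φ => Hol.ofBounds hα (fun _ => ∫ y, φ y * H y ∂ν) _ 0
        (fun _ => hH.abs_integral_mul_le φ.toBCF) (hD _)
      map_add' := fun φ ψ => ?_
      map_smul' := fun c φ => ?_ } 1 fun φ => ?_, fun φ x => rfl⟩
  · ext x
    simp only [Hol.ofBounds_apply, Hol.add_apply, add_mul]
    exact integral_add (hi φ) (hi ψ)
  · ext x
    simp only [Hol.ofBounds_apply, Hol.smul_apply, RingHom.id_apply, mul_assoc]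
    exact integral_const_mul _ _
  · refine (Hol.norm_le_of_bounds _ (norm_nonneg _) le_rfl
      (fun _ => hH.abs_integral_mul_le φ.toBCF) (hD _)).trans ?_
    rw [add_zero, one_mul]
    exact φ.norm_toBCF_le

end IsNormalizedEigenfunction

end

noncomputable section

/-! ### Exponential decay -/

open ShiftSpace

theorem abs_div_sub_div_le {a a' b b' m : ℝ} (hm : 0 < m) (hb : m ≤ b) (hb' : m ≤ b') :
    |a / b - a' / b'| ≤ |a - a'| / m + |a'| * |b - b'| / m ^ 2 := by
  have hb0 : 0 < b := hm.trans_le hb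
  have hb0' : 0 < b' := hm.trans_le hb'
  have e : a / b - a' / b' = (a - a') / b + a' * (b' - b) / (b * b') := by
    field_simp; ring
  rw [e]
  refine (abs_add_le _ _).trans (add_le_add ?_ ?_)
  · rw [abs_div, abs_of_pos hb0]
    exact div_le_div_of_nonneg_left (abs_nonneg _) hm hb
  · rw [abs_div, abs_of_pos (mul_pos hb0 hb0'), abs_mul, abs_sub_comm b' b]
    refine div_le_div_of_nonneg_left (by positivity) (by positivity) ?_
    rw [sq]
    exact mul_le_mul hb hb' hm.le hb0.le

namespace IsNormalizedEigenfunction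

variable {E : Type*} [MetricSpace E] [MeasurableSpace E] [BorelSpace E]
  {p : Measure E} [IsProbabilityMeasure p] {f : ShiftSpace E →ᵇ ℝ}
  {ν : Measure (ShiftSpace E)} [IsProbabilityMeasure ν] {lam : ℝ} {α : ℝ≥0} {K : ℝ}
  {H : Hol (ShiftSpace E) α}

omit [IsProbabilityMeasure ν] in
theorem abs_div_sub_div_le (hH : IsNormalizedEigenfunction p f ν lam K H)
    (φ : Hol (ShiftSpace E) α) {B M : ℝ}
    (hB : ∀ x y, |φ x - φ y| ≤ B * dist x y ^ (α : ℝ)) (hM : ∀ x, |φ x| ≤ M)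
    (x y : ShiftSpace E) :
    |φ x / H x - φ y / H y| ≤ (B / Real.exp (-K)
      + M * nnHolderNorm α (H : ShiftSpace E → ℝ) / Real.exp (-K) ^ 2) * dist x y ^ (α : ℝ) := by
  refine (_root_.abs_div_sub_div_le (Real.exp_pos (-K)) (hH.exp_neg_le x)
    (hH.exp_neg_le y)).trans ?_
  rw [add_mul, div_mul_eq_mul_div, div_mul_eq_mul_div]
  refine add_le_add (div_le_div_of_nonneg_right (hB x y) (Real.exp_pos _).le)
    (div_le_div_of_nonneg_right ?_ (by positivity))
  rw [mul_assoc]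
  exact mul_le_mul (hM y) (H.abs_sub_le x y) (abs_nonneg _) ((abs_nonneg _).trans (hM y))

/-- Iterated quotients of a function of zero mean decay uniformly. -/
theorem abs_ruelleEnd_pow_div_le (hH : IsNormalizedEigenfunction p f ν lam K H)
    {φ : ShiftSpace E →ᵇ ℝ} (hφ : ∫ x, φ x ∂ν = 0) {B : ℝ} (hB : 0 ≤ B) (n : ℕ)
    (h : ∀ x y, |(ruelleEnd p f ^ n) φ x / (ruelleEnd p f ^ n) H.toBCF x
      - (ruelleEnd p f ^ n) φ y / (ruelleEnd p f ^ n) H.toBCF y| ≤ B * dist x y ^ (α : ℝ))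
    (x : ShiftSpace E) :
    |(ruelleEnd p f ^ n) φ x / (ruelleEnd p f ^ n) H.toBCF x| ≤ B := by
  have hpos := ruelleEnd_pow_pos p f hH.pos n
  have hmul : (fun x => (ruelleEnd p f ^ n) φ x / (ruelleEnd p f ^ n) H.toBCF x
      * (ruelleEnd p f ^ n) H.toBCF x) = (ruelleEnd p f ^ n) φ :=
    funext fun x => div_mul_cancel₀ _ (hpos x).ne'
  have h1 := abs_sub_le_of_integral_mul_eq (ν := ν) (c := 0) (B := B)
    (g := fun x => (ruelleEnd p f ^ n) φ x / (ruelleEnd p f ^ n) H.toBCF x)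
    (((ruelleEnd p f ^ n) H.toBCF).integrable ν)
    (by rw [hmul]; exact ((ruelleEnd p f ^ n) φ).integrable ν) (fun x => (hpos x).le)
    (by
      rw [integral_ruelleEnd_pow hH.conformal, hH.integral_eq_one, mul_one]
      exact pow_pos hH.lam_pos n)
    (by rw [hmul, integral_ruelleEnd_pow hH.conformal, hφ, mul_zero, zero_mul])
    (fun x y => (h x y).trans (mul_le_of_le_one_right hB (dist_rpow_le_one x y α))) x
  rwa [sub_zero] at h1

/-- A general `ψ` need not satisfy the distortion bound with the fixed `K`, so `L^n ψ` cannot serve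
as denominator in the contraction. Dividing numerator and denominator by `L^n H` writes the quantity
as `q / g`: `q` decays at rate `r`, while `g` stays Hölder and bounded below. Thus `ψ` affects the
constant but not the rate. -/
theorem exists_isDecayRate (hH : IsNormalizedEigenfunction p f ν lam K H) (hα : 0 < α)
    {D : ℝ} (hf : ∀ x y, |f x - f y| ≤ D * dist x y ^ (α : ℝ)) (hK0 : 0 < K)
    (hK : (D + K) * (1 / 2 : ℝ) ^ (α : ℝ) ≤ K) :
    ∃ s : ℝ, 0 < s ∧ s < 1 ∧ IsDecayRate p f ν α s := by
  obtain ⟨C, r, hC, hr0, hr1, hCr⟩ := exists_ruelleEnd_pow_div_abs_sub_le p hα hf hK0 hK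
  refine ⟨r, hr0, hr1, fun ψ ⟨c, hc, hψ⟩ => ?_⟩
  obtain ⟨a₀⟩ : Nonempty E := nonempty_of_isProbabilityMeasure p
  set m := Real.exp (-K) with hm
  have hm0 : 0 < m := Real.exp_pos _
  set dH : ℝ := ((nnHolderNorm α (H : ShiftSpace E → ℝ) : ℝ≥0) : ℝ) with hdH
  set dψ : ℝ := ((nnHolderNorm α (ψ : ShiftSpace E → ℝ) : ℝ≥0) : ℝ) with hdψ
  have hdH0 : 0 ≤ dH := NNReal.coe_nonneg _
  have hdψ0 : 0 ≤ dψ := NNReal.coe_nonneg _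
  set C₁ := 1 / m + dH / m ^ 2 with hC₁
  set C₂ := dψ / m + ‖ψ.toBCF‖ * dH / m ^ 2 with hC₂
  have hC₁0 : 0 < C₁ := by positivity
  have hC₂0 : 0 ≤ C₂ := by positivity
  -- Lower bound for `g`: since `H ≤ exp K`, one has `c exp (-K) H ≤ c ≤ ψ`, and `L^n` preserves
  -- this order.
  set m' := c * m with hm'
  have hm'0 : 0 < m' := by positivity
  set C₃ := C * C₁ * (1 / m' + C * C₂ / m' ^ 2) with hC₃
  have hC₃0 : 0 < C₃ := by positivity
  have hψ0 : ∀ x, 0 < ψ x := fun x => hc.trans_le (hψ x)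
  set S := ⨆ x, |1 / ψ x| with hS
  have hS0 : 0 < S := by
    have hbdd : BddAbove (Set.range fun x => |1 / ψ x|) := by
      refine ⟨1 / c, ?_⟩
      rintro _ ⟨x, rfl⟩
      simp only [abs_of_pos (one_div_pos.2 (hψ0 x))]
      exact one_div_le_one_div_of_le hc (hψ x)
    exact (abs_pos.2 (one_div_pos.2 (hψ0 (ofPi fun _ => a₀))).ne').trans_le
      (le_ciSup hbdd (ofPi fun _ => a₀))
  have hνψ : 0 < ∫ y, ψ y ∂ν := by
    have h : ∫ _, c ∂ν ≤ ∫ y, ψ y ∂ν :=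
      integral_mono (integrable_const _) (ψ.toBCF.integrable ν) hψ
    rw [integral_const, probReal_univ, one_smul] at h
    exact hc.trans_le h
  -- Dividing by `S = ‖1/ψ‖_∞` cancels the last factor of the required bound; this uses `S > 0`.
  refine ⟨C₃ / S, by positivity, fun φ n => ?_⟩
  set c₀ := (∫ y, φ y ∂ν) / ∫ y, ψ y ∂ν with hc₀
  set D₀ : ℝ := ((nnHolderNorm α (φ : ShiftSpace E → ℝ) : ℝ≥0) : ℝ) + |c₀| * dψ with hD₀
  have hD₀0 : 0 ≤ D₀ := by positivity
  have hLψ := ruelleEnd_pow_pos p f hψ0 n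
  have hLH := ruelleEnd_pow_pos p f hH.pos n
  -- reduction to a function of zero mean
  let φ₀ : Hol (ShiftSpace E) α := φ - c₀ • ψ
  have hφ₀D : ∀ x y, |φ₀ x - φ₀ y| ≤ D₀ * dist x y ^ (α : ℝ) := fun x y => by
    have e : φ₀ x - φ₀ y = (φ x - φ y) - c₀ * (ψ x - ψ y) := by
      simp only [φ₀, Hol.sub_apply, Hol.smul_apply]; ring
    rw [e, hD₀, add_mul, mul_assoc]
    refine (abs_sub _ _).trans (add_le_add (φ.abs_sub_le x y) ?_)
    rw [abs_mul]
    exact mul_le_mul_of_nonneg_left (ψ.abs_sub_le x y) (abs_nonneg _)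
  have hφ₀i : ∫ x, φ₀ x ∂ν = 0 := by
    simp only [φ₀, Hol.sub_apply, Hol.smul_apply]
    rw [integral_sub (φ.toBCF.integrable ν) ((ψ.toBCF.integrable ν).const_mul _),
      integral_const_mul, hc₀, div_mul_cancel₀ _ hνψ.ne', sub_self]
  have hφ₀M : ∀ x, |φ₀ x| ≤ D₀ := fun x => by
    have h := abs_sub_le_of_integral_mul_eq (ν := ν) (g := φ₀) (w := fun _ => 1) (c := 0) (B := D₀)
      (integrable_const _) (by simpa using φ₀.toBCF.integrable ν) (fun _ => zero_le_one)
      (by simp) (by simpa using hφ₀i)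
      (fun x y => (hφ₀D x y).trans (mul_le_of_le_one_right hD₀0 (dist_rpow_le_one x y α))) x
    rwa [sub_zero] at h
  have hLφ₀ : ∀ x, (ruelleEnd p f ^ n) φ₀.toBCF x
      = (ruelleEnd p f ^ n) φ.toBCF x - c₀ * (ruelleEnd p f ^ n) ψ.toBCF x := fun x => by
    rw [show φ₀.toBCF = φ.toBCF - c₀ • ψ.toBCF from rfl, map_sub, map_smul]; rfl
  let q : ShiftSpace E → ℝ := fun x =>
    (ruelleEnd p f ^ n) φ₀.toBCF x / (ruelleEnd p f ^ n) H.toBCF x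
  let g : ShiftSpace E → ℝ := fun x =>
    (ruelleEnd p f ^ n) ψ.toBCF x / (ruelleEnd p f ^ n) H.toBCF x
  have hq : ∀ x y, |q x - q y| ≤ C * r ^ n * (C₁ * D₀) * dist x y ^ (α : ℝ) :=
    hCr H.toBCF φ₀.toBCF hH.logHolder hH.pos (C₁ * D₀) (by positivity) (fun x y => by
      refine (hH.abs_div_sub_div_le φ₀ hφ₀D hφ₀M x y).trans_eq ?_
      rw [hC₁]; ring) n
  have hq' : ∀ x, |q x| ≤ C * r ^ n * (C₁ * D₀) :=
    hH.abs_ruelleEnd_pow_div_le hφ₀i (by positivity) n hq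
  have hg : ∀ x y, |g x - g y| ≤ C * C₂ * dist x y ^ (α : ℝ) := fun x y => by
    refine (hCr H.toBCF ψ.toBCF hH.logHolder hH.pos C₂ hC₂0
      (hH.abs_div_sub_div_le ψ ψ.abs_sub_le ψ.abs_le) n x y).trans
      (mul_le_mul_of_nonneg_right (mul_le_mul_of_nonneg_right ?_ hC₂0) (by positivity))
    exact mul_le_of_le_one_right hC.le (pow_le_one₀ hr0.le hr1.le)
  have hg' : ∀ x, m' ≤ g x := fun x => by
    have h := ruelleEnd_pow_mono p f (φ := m' • H.toBCF) (ψ := ψ.toBCF) (fun y => by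
      refine le_trans ?_ (hψ y)
      rw [bcf_smul_apply, hm', mul_assoc]
      refine mul_le_of_le_one_right hc.le ?_
      have h := mul_le_mul_of_nonneg_left (hH.le_exp y) hm0.le
      rwa [hm, ← Real.exp_add, neg_add_cancel, Real.exp_zero] at h) n x
    rw [map_smul, bcf_smul_apply] at h
    exact (le_div_iff₀ (hLH x)).2 h
  have hqg : ∀ x, (ruelleEnd p f ^ n) φ.toBCF x / (ruelleEnd p f ^ n) ψ.toBCF x - c₀
      = q x / g x := fun x => by
    have h1 := (hLψ x).ne'
    have h2 := (hLH x).ne'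
    simp only [q, g, hLφ₀]
    field_simp
  simp only [iterate_ruelle, hqg]
  refine eHolderNorm_le_ofReal fun x y => ?_
  have hfin : C₃ / S * r ^ n * D₀ * S = C₃ * r ^ n * D₀ := by field_simp
  rw [hfin]
  calc |q x / g x - q y / g y|
      ≤ |q x - q y| / m' + |q y| * |g x - g y| / m' ^ 2 :=
        _root_.abs_div_sub_div_le hm'0 (hg' x) (hg' y)
    _ ≤ C * r ^ n * (C₁ * D₀) * dist x y ^ (α : ℝ) / m'
        + C * r ^ n * (C₁ * D₀) * (C * C₂ * dist x y ^ (α : ℝ)) / m' ^ 2 :=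
        add_le_add (div_le_div_of_nonneg_right (hq x y) hm'0.le)
          (div_le_div_of_nonneg_right
            (mul_le_mul (hq' y) (hg x y) (abs_nonneg _) (by positivity)) (by positivity))
    _ = C₃ * r ^ n * D₀ * dist x y ^ (α : ℝ) := by rw [hC₃]; ring

omit [IsProbabilityMeasure ν] in
theorem integral_normalizedOperator_mul (hH : IsNormalizedEigenfunction p f ν lam K H)
    {Q : Hol (ShiftSpace E) α →L[ℝ] Hol (ShiftSpace E) α}
    (hQ : ∀ φ x, Q φ x = ruelleEnd p f (H.toBCF * φ.toBCF) x / (lam * H x))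
    (φ : Hol (ShiftSpace E) α) : ∫ x, Q φ x * H x ∂ν = ∫ x, φ x * H x ∂ν := by
  have h1 : ∀ x, Q φ x * H x = ruelleEnd p f (H.toBCF * φ.toBCF) x / lam := fun x => by
    have := (hH.pos x).ne'
    have := hH.lam_pos.ne'
    rw [hQ]
    field_simp
  simp_rw [h1]
  rw [integral_div, coe_ruelleEnd, hH.conformal, mul_div_cancel_left₀ _ hH.lam_pos.ne']
  exact integral_congr_ae (ae_of_all _ fun x => mul_comm _ _)

omit [IsProbabilityMeasure ν] in
theorem normalizedOperator_apply_of_const (hH : IsNormalizedEigenfunction p f ν lam K H)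
    {Q : Hol (ShiftSpace E) α →L[ℝ] Hol (ShiftSpace E) α}
    (hQ : ∀ φ x, Q φ x = ruelleEnd p f (H.toBCF * φ.toBCF) x / (lam * H x))
    {φ : Hol (ShiftSpace E) α} {c : ℝ} (hφ : ∀ x, φ x = c) : Q φ = φ := by
  ext x
  have h1 : H.toBCF * φ.toBCF = c • H.toBCF := by
    ext y
    rw [BoundedContinuousFunction.coe_mul, Pi.mul_apply, hφ, bcf_smul_apply, mul_comm]
  rw [hQ, h1, map_smul, bcf_smul_apply, hH.ruelleEnd_eigen_apply, hφ,
    mul_div_cancel_right₀ _ (mul_pos hH.lam_pos (hH.pos x)).ne']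

/-- With `ψ = H` and numerator `H φ`, the decaying expression is exactly `Q^n φ - P φ`. Its `H
dν`-mean vanishes, so the seminorm bound also bounds the supremum. -/
theorem norm_sub_le_of_isDecayRate (hH : IsNormalizedEigenfunction p f ν lam K H)
    {Q P : Hol (ShiftSpace E) α →L[ℝ] Hol (ShiftSpace E) α}
    (hQ : ∀ φ x, Q φ x = ruelleEnd p f (H.toBCF * φ.toBCF) x / (lam * H x))
    (hP : ∀ φ x, P φ x = ∫ y, φ y * H y ∂ν) {s : ℝ} (hs0 : 0 < s)
    (hs : IsDecayRate p f ν α s) :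
    ∃ C : ℝ, 0 < C ∧ ∀ n : ℕ, ‖Q ^ n - P‖ ≤ C * s ^ n := by
  obtain ⟨C, hC, hCs⟩ := hs H ⟨_, Real.exp_pos _, hH.exp_neg_le⟩
  set S := ⨆ x, |1 / H x| with hS
  have hS0 : 0 ≤ S := Real.iSup_nonneg fun x => abs_nonneg _
  -- The 3 is 2 from the product rule for `H φ` plus 1 from the mean term; the outer 2 counts
  -- supremum and seminorm; the 1 makes positivity immediate.
  refine ⟨2 * (3 * C * ‖H‖ * S) + 1, by positivity, fun n => ?_⟩
  refine ContinuousLinearMap.opNorm_le_bound _ (by positivity) fun φ => ?_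
  have hHφD : ∀ x y, |H x * φ x - H y * φ y| ≤ 2 * ‖H‖ * ‖φ‖ * dist x y ^ (α : ℝ) :=
    fun x y => by
    have e : H x * φ x - H y * φ y = H x * (φ x - φ y) + φ y * (H x - H y) := by ring
    have h1 := mul_le_mul ((H.abs_le x).trans H.norm_toBCF_le) ((φ.abs_sub_le x y).trans
      (mul_le_mul_of_nonneg_right φ.nnHolderNorm_le (by positivity))) (abs_nonneg _)
      (norm_nonneg H)
    have h2 := mul_le_mul ((φ.abs_le y).trans φ.norm_toBCF_le) ((H.abs_sub_le x y).trans
      (mul_le_mul_of_nonneg_right H.nnHolderNorm_le (by positivity))) (abs_nonneg _)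
      (norm_nonneg φ)
    rw [← abs_mul] at h1 h2
    rw [e]
    refine (abs_add_le _ _).trans ?_
    linarith
  let φ' : Hol (ShiftSpace E) α := ⟨H.toBCF * φ.toBCF, (holderWith_of_abs_sub_le hHφD).memHolder⟩
  have hφ' : ∀ x, φ' x = H x * φ x := fun x => rfl
  have hφ'D : (nnHolderNorm α (φ' : ShiftSpace E → ℝ) : ℝ) ≤ 2 * ‖H‖ * ‖φ‖ :=
    nnHolderNorm_le_of_abs_sub_le (by positivity) hHφD
  have hi : ∫ y, φ' y ∂ν = ∫ y, φ y * H y ∂ν :=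
    integral_congr_ae (ae_of_all _ fun y => mul_comm _ _)
  have hi' : |∫ y, φ' y ∂ν| ≤ ‖φ‖ := by
    rw [hi]; exact (hH.abs_integral_mul_le φ.toBCF).trans φ.norm_toBCF_le
  set u : Hol (ShiftSpace E) α := (Q ^ n - P) φ with hu
  have hux : ∀ x, u x = (ruelle p f)^[n] φ' x / (ruelle p f)^[n] H x
      - (∫ y, φ' y ∂ν) / ∫ y, H y ∂ν := fun x => by
    rw [hu, sub_apply, Hol.sub_apply, hP,
      hH.normalizedOperator_pow_apply hQ, iterate_ruelle, iterate_ruelle,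
      hH.ruelleEnd_pow_eigen_apply, hH.integral_eq_one, div_one, hi]
    rfl
  set R := 3 * C * ‖H‖ * S * s ^ n * ‖φ‖ with hR
  have hR0 : 0 ≤ R := by positivity
  have hRle : C * s ^ n * (nnHolderNorm α (φ' : ShiftSpace E → ℝ)
      + |(∫ y, φ' y ∂ν) / ∫ y, H y ∂ν| * nnHolderNorm α (H : ShiftSpace E → ℝ)) * S ≤ R := by
    rw [hH.integral_eq_one, div_one]
    have h1 := mul_le_mul hi' H.nnHolderNorm_le (NNReal.coe_nonneg _) (norm_nonneg φ)
    calc _ ≤ C * s ^ n * (2 * ‖H‖ * ‖φ‖ + ‖φ‖ * ‖H‖) * S :=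
          mul_le_mul_of_nonneg_right
            (mul_le_mul_of_nonneg_left (add_le_add hφ'D h1) (by positivity)) hS0
      _ = R := by rw [hR]; ring
  have huD : ∀ x y, |u x - u y| ≤ R * dist x y ^ (α : ℝ) :=
    abs_sub_le_of_eHolderNorm_le hR0 (by
      rw [show (u : ShiftSpace E → ℝ) = _ from funext hux]
      exact (hCs φ' n).trans (ENNReal.ofReal_le_ofReal hRle))
  have huM : ∀ x, |u x| ≤ R := fun x => by
    have hint : ∫ y, u y * H y ∂ν = 0 := by
      have h1 : ∀ y, u y * H y = (lam ^ n)⁻¹ * (ruelleEnd p f ^ n) φ'.toBCF y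
          - (∫ z, φ' z ∂ν) * H y := fun y => by
        have := (hH.pos y).ne'
        have := hH.lam_pos.ne'
        rw [hux, iterate_ruelle, iterate_ruelle, hH.ruelleEnd_pow_eigen_apply,
          hH.integral_eq_one, div_one]
        field_simp
      simp_rw [h1]
      rw [integral_sub ((((ruelleEnd p f ^ n) φ'.toBCF).integrable ν).const_mul _)
        ((H.toBCF.integrable ν).const_mul _), integral_const_mul, integral_const_mul,
        integral_ruelleEnd_pow hH.conformal, hH.integral_eq_one, mul_one,
        inv_mul_cancel_left₀ (pow_pos hH.lam_pos n).ne', sub_self]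
    have h := abs_sub_le_of_integral_mul_eq (ν := ν) (g := u) (w := H) (c := 0) (B := R)
      (H.toBCF.integrable ν) ((u.toBCF * H.toBCF).integrable ν) (fun x => (hH.pos x).le)
      (by rw [hH.integral_eq_one]; exact one_pos) (by rw [hint, zero_mul])
      (fun x y => (huD x y).trans (mul_le_of_le_one_right hR0 (dist_rpow_le_one x y α))) x
    rwa [sub_zero] at h
  refine (u.norm_le_of_bounds hR0 hR0 huM huD).trans ?_
  have : 0 ≤ s ^ n * ‖φ‖ := by positivity
  have e : (2 * (3 * C * ‖H‖ * S) + 1) * s ^ n * ‖φ‖ = R + R + s ^ n * ‖φ‖ := by rw [hR]; ring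
  linarith

end IsNormalizedEigenfunction

/-- All mixed terms collapse to `e`. The exponent starts at 1 because at 0 the right side would be
`1 - e`. -/
theorem sub_pow_succ_of_mul_eq {R : Type*} [Ring R] {q e : R} (hqe : q * e = e) (heq : e * q = e)
    (hee : e * e = e) (n : ℕ) : (q - e) ^ (n + 1) = q ^ (n + 1) - e := by
  have h : ∀ n, e * q ^ n = e := fun n => by
    induction n with
    | zero => simp
    | succ n ih => rw [pow_succ, ← mul_assoc, ih, heq]
  induction n with
  | zero => simp
  | succ n ih =>
    rw [pow_succ', ih, sub_mul, mul_sub, mul_sub, hqe, h, hee, ← pow_succ', sub_self, sub_zero]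

end

noncomputable section

/-! ### Existence of a conformal measure -/

open ShiftSpace

/-- Two finite Borel measures on a metric space that give the same integrals to bounded Lipschitz
functions are equal. -/
theorem ext_of_forall_lipschitz_integral_eq {X : Type*} [MetricSpace X] [MeasurableSpace X]
    [BorelSpace X] {μ ν : Measure X} [IsFiniteMeasure μ] [IsFiniteMeasure ν]
    (h : ∀ φ : X →ᵇ ℝ, (∃ C, LipschitzWith C φ) → ∫ x, φ x ∂μ = ∫ x, φ x ∂ν) : μ = ν := by
  have hclosed : ∀ F : Set X, IsClosed F → μ F = ν F := fun F hF => by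
    have hδ : ∀ n : ℕ, (0 : ℝ) < 1 / (n + 1) := fun n => by positivity
    have hlim := tendsto_one_div_add_atTop_nhds_zero_nat (𝕜 := ℝ)
    refine tendsto_nhds_unique (tendsto_lintegral_thickenedIndicator_of_isClosed μ hF hδ hlim)
      ((tendsto_lintegral_thickenedIndicator_of_isClosed ν hF hδ hlim).congr fun n => ?_)
    set g := thickenedIndicator (hδ n) F
    have hL : LipschitzWith (1 * (1 / ((n : ℝ) + 1)).toNNReal⁻¹) fun x => (g x : ℝ) :=
      NNReal.isometry_coe.lipschitz.comp (lipschitzWith_thickenedIndicator (hδ n) F)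
    have h1 := h (BoundedContinuousFunction.ofNormedAddCommGroup (fun x => (g x : ℝ))
      hL.continuous 1 fun x => by
        rw [Real.norm_of_nonneg (NNReal.coe_nonneg _)]
        exact NNReal.coe_le_one.2 (thickenedIndicator_le_one (hδ n) F x)) ⟨_, hL⟩
    simp only [BoundedContinuousFunction.coe_ofNormedAddCommGroup] at h1
    rw [← BoundedContinuousFunction.toReal_lintegral_coe_eq_integral,
      ← BoundedContinuousFunction.toReal_lintegral_coe_eq_integral] at h1
    exact ((ENNReal.toReal_eq_toReal_iff' (g.lintegral_lt_top_of_nnreal μ).ne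
      (g.lintegral_lt_top_of_nnreal ν).ne).1 h1).symm
  exact ext_of_generate_finite {F | IsClosed F}
    (by rw [BorelSpace.measurable_eq (α := X), borel_eq_generateFrom_isClosed])
    isPiSystem_isClosed (fun F hF => hclosed F hF) (hclosed _ isClosed_univ)

variable {E : Type*} [MetricSpace E] [MeasurableSpace E] [BorelSpace E]

/-- The dual of the Ruelle operator, acting on measures. -/
def ruelleDual (p : Measure E) (f : ShiftSpace E →ᵇ ℝ) (m : Measure (ShiftSpace E)) :
    Measure (ShiftSpace E) :=
  ((m.prod p).withDensity fun q => ENNReal.ofReal (Real.exp (f (cons q.2 q.1)))).map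
    fun q => cons q.2 q.1

/-! ### The dual operator and tightness of its normalized iterates -/

section Dual

variable [SecondCountableTopology E] (p : Measure E) [IsProbabilityMeasure p]
  (f : ShiftSpace E →ᵇ ℝ) (m : Measure (ShiftSpace E)) [IsFiniteMeasure m]

omit [MeasurableSpace E] [BorelSpace E] [SecondCountableTopology E] in
theorem continuous_cons_swap : Continuous fun q : ShiftSpace E × E => cons q.2 q.1 :=
  continuous_cons.comp continuous_swap

theorem measurable_cons_swap : Measurable fun q : ShiftSpace E × E => cons q.2 q.1 :=
  continuous_cons_swap.measurable

theorem measurable_ofReal_exp_cons :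
    Measurable fun q : ShiftSpace E × E => ENNReal.ofReal (Real.exp (f (cons q.2 q.1))) :=
  ENNReal.measurable_ofReal.comp (f.continuous.comp continuous_cons_swap).rexp.measurable

omit [IsProbabilityMeasure p] [IsFiniteMeasure m] in
theorem ruelleDual_apply {S : Set (ShiftSpace E)} (hS : MeasurableSet S) :
    ruelleDual p f m S = ∫⁻ q in (fun q : ShiftSpace E × E => cons q.2 q.1) ⁻¹' S,
      ENNReal.ofReal (Real.exp (f (cons q.2 q.1))) ∂(m.prod p) := by
  rw [ruelleDual, Measure.map_apply measurable_cons_swap hS,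
    withDensity_apply _ (measurable_cons_swap hS)]

omit [IsProbabilityMeasure p] [IsFiniteMeasure m] in
theorem ruelleDual_le {S : Set (ShiftSpace E)} (hS : MeasurableSet S) :
    ruelleDual p f m S ≤ ENNReal.ofReal (Real.exp ‖f‖)
      * (m.prod p) ((fun q : ShiftSpace E × E => cons q.2 q.1) ⁻¹' S) := by
  rw [ruelleDual_apply p f m hS, ← setLIntegral_const]
  exact lintegral_mono fun q => ENNReal.ofReal_le_ofReal
    (Real.exp_le_exp.2 ((le_abs_self _).trans (f.norm_coe_le_norm _)))

omit [IsProbabilityMeasure p] [IsFiniteMeasure m] in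
-- The density is at least `exp (-‖f‖)`. This reverse comparison lets total masses be renormalized
-- after each dual step.
theorem prod_preimage_cons_le {S : Set (ShiftSpace E)} (hS : MeasurableSet S) :
    (m.prod p) ((fun q : ShiftSpace E × E => cons q.2 q.1) ⁻¹' S)
      ≤ ENNReal.ofReal (Real.exp ‖f‖) * ruelleDual p f m S := by
  rw [ruelleDual_apply p f m hS, ← lintegral_const_mul _ (measurable_ofReal_exp_cons f),
    ← one_mul ((m.prod p) _), ← setLIntegral_const]
  refine lintegral_mono fun q => ?_
  rw [← ENNReal.ofReal_mul (Real.exp_pos _).le, ← Real.exp_add, ENNReal.one_le_ofReal,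
    Real.one_le_exp_iff]
  have := neg_le_of_abs_le (f.norm_coe_le_norm (cons q.2 q.1))
  linarith

omit [IsFiniteMeasure m] in
theorem measure_univ_le_ruelleDual :
    m Set.univ ≤ ENNReal.ofReal (Real.exp ‖f‖) * ruelleDual p f m Set.univ := by
  have h := prod_preimage_cons_le p f m MeasurableSet.univ
  rwa [Set.preimage_univ, ← Set.univ_prod_univ, Measure.prod_prod, measure_univ (μ := p), mul_one] at h

instance isFiniteMeasure_ruelleDual : IsFiniteMeasure (ruelleDual p f m) :=
  ⟨(ruelleDual_le p f m MeasurableSet.univ).trans_lt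
    (ENNReal.mul_lt_top ENNReal.ofReal_lt_top (measure_lt_top _ _))⟩

omit [SecondCountableTopology E] in
theorem measurableSet_coord (i : ℕ) {B : Set E} (hB : MeasurableSet B) :
    MeasurableSet {x : ShiftSpace E | x i ∈ B} :=
  (continuous_coord i).measurable hB

omit [IsFiniteMeasure m] in
theorem ruelleDual_coord_zero_le {B : Set E} (hB : MeasurableSet B) :
    ruelleDual p f m {x | x 0 ∈ B} ≤ ENNReal.ofReal (Real.exp ‖f‖) * (p B * m Set.univ) := by
  refine (ruelleDual_le p f m (measurableSet_coord 0 hB)).trans_eq ?_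
  have e : (fun q : ShiftSpace E × E => cons q.2 q.1) ⁻¹' {x | x 0 ∈ B} = Set.univ ×ˢ B := by
    ext q; simp
  rw [e, Measure.prod_prod, mul_comm (p B)]

omit [IsFiniteMeasure m] in
theorem ruelleDual_coord_succ_le (i : ℕ) {B : Set E} (hB : MeasurableSet B) :
    ruelleDual p f m {x | x (i + 1) ∈ B}
      ≤ ENNReal.ofReal (Real.exp ‖f‖) * m {x | x i ∈ B} := by
  refine (ruelleDual_le p f m (measurableSet_coord (i + 1) hB)).trans_eq ?_
  have e : (fun q : ShiftSpace E × E => cons q.2 q.1) ⁻¹' {x | x (i + 1) ∈ B}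
      = {x | x i ∈ B} ×ˢ Set.univ := by
    ext q; simp
  rw [e, Measure.prod_prod, measure_univ (μ := p), mul_one]

theorem integral_ruelleDual (φ : ShiftSpace E →ᵇ ℝ) :
    ∫ x, φ x ∂(ruelleDual p f m) = ∫ x, ruelle p f φ x ∂m := by
  rw [ruelleDual, integral_map measurable_cons_swap.aemeasurable
    (φ.continuous.aestronglyMeasurable),
    integral_withDensity_eq_integral_toReal_smul (measurable_ofReal_exp_cons f)
      (ae_of_all _ fun q => ENNReal.ofReal_lt_top)]
  simp only [ENNReal.toReal_ofReal (Real.exp_pos _).le, smul_eq_mul]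
  rw [integral_prod]
  · rfl
  · exact Integrable.of_bound ((f.continuous.comp continuous_cons_swap).rexp.mul
      (φ.continuous.comp continuous_cons_swap)).aestronglyMeasurable
      (Real.exp ‖f‖ * ‖φ‖) (ae_of_all _ fun q => abs_exp_mul_le f φ _)

/-- The iterates of the dual operator applied to a Dirac mass. -/
def ruelleDualIter (z : ShiftSpace E) (n : ℕ) : Measure (ShiftSpace E) :=
  (ruelleDual p f)^[n] (Measure.dirac z)

omit [BorelSpace E] [SecondCountableTopology E] [IsProbabilityMeasure p] in
theorem ruelleDualIter_succ (z : ShiftSpace E) (n : ℕ) :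
    ruelleDualIter p f z (n + 1) = ruelleDual p f (ruelleDualIter p f z n) :=
  Function.iterate_succ_apply' _ _ _

instance isFiniteMeasure_ruelleDualIter (z : ShiftSpace E) (n : ℕ) :
    IsFiniteMeasure (ruelleDualIter p f z n) := by
  induction n with
  | zero => exact inferInstanceAs (IsFiniteMeasure (Measure.dirac z))
  | succ n ih => rw [ruelleDualIter_succ]; infer_instance

theorem integral_ruelleDualIter (z : ShiftSpace E) (n : ℕ) (φ : ShiftSpace E →ᵇ ℝ) :
    ∫ x, φ x ∂(ruelleDualIter p f z n) = (ruelleEnd p f ^ n) φ z := by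
  induction n generalizing φ with
  | zero => exact integral_dirac' _ _ φ.continuous.stronglyMeasurable
  | succ n ih =>
    rw [ruelleDualIter_succ, integral_ruelleDual, ← coe_ruelleEnd, ih, ruelleEnd_pow_succ']

/-- Each dual step shifts the coordinates and inserts a `p`-distributed letter, at cost `c` for the
density and `c` for renormalizing the mass. Coordinate `i` is traced back at most `i + 1` steps,
whence the exponent `2 (i + 1)` independent of `n`; coordinates still inherited from `z` avoid `B`.
-/
theorem ruelleDualIter_coord_le {z : ShiftSpace E} {B : Set E} (hB : MeasurableSet B)
    (hz : ∀ i, z i ∉ B) (n i : ℕ) :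
    ruelleDualIter p f z n {x | x i ∈ B} ≤ ENNReal.ofReal (Real.exp ‖f‖) ^ (2 * (i + 1))
      * p B * ruelleDualIter p f z n Set.univ := by
  set c := ENNReal.ofReal (Real.exp ‖f‖)
  induction n generalizing i with
  | zero =>
    have h : ruelleDualIter p f z 0 {x | x i ∈ B} = 0 := by
      rw [ruelleDualIter, Function.iterate_zero, id,
        Measure.dirac_apply' z (measurableSet_coord i hB), Set.indicator_of_notMem]
      exact hz i
    rw [h]; exact zero_le
  | succ n ih =>
    rw [ruelleDualIter_succ]
    have hu := measure_univ_le_ruelleDual p f (ruelleDualIter p f z n)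
    cases i with
    | zero =>
      calc _ ≤ c * (p B * ruelleDualIter p f z n Set.univ) :=
            ruelleDual_coord_zero_le p f _ hB
        _ ≤ c * (p B * (c * ruelleDual p f (ruelleDualIter p f z n) Set.univ)) := by gcongr
        _ = _ := by ring
    | succ i =>
      calc _ ≤ c * ruelleDualIter p f z n {x | x i ∈ B} := ruelleDual_coord_succ_le p f _ i hB
        _ ≤ c * (c ^ (2 * (i + 1)) * p B * ruelleDualIter p f z n Set.univ) := by
            gcongr; exact ih i
        _ ≤ c * (c ^ (2 * (i + 1)) * p B
              * (c * ruelleDual p f (ruelleDualIter p f z n) Set.univ)) := by gcongr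
        _ = _ := by ring

theorem ruelleDualIter_univ_ne_zero (z : ShiftSpace E) (n : ℕ) :
    ruelleDualIter p f z n Set.univ ≠ 0 := by
  induction n with
  | zero => simp [ruelleDualIter]
  | succ n ih =>
    rw [ruelleDualIter_succ]
    intro h
    have hu := measure_univ_le_ruelleDual p f (ruelleDualIter p f z n)
    rw [h, mul_zero] at hu
    exact ih (le_antisymm hu zero_le)

/-- The normalized iterates of the dual operator. -/
def ruelleDualProb (z : ShiftSpace E) (n : ℕ) : ProbabilityMeasure (ShiftSpace E) :=
  ⟨(ruelleDualIter p f z n Set.univ)⁻¹ • ruelleDualIter p f z n, ⟨by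
    rw [Measure.smul_apply, smul_eq_mul]
    exact ENNReal.inv_mul_cancel (ruelleDualIter_univ_ne_zero p f z n) (measure_ne_top _ _)⟩⟩

theorem coe_ruelleDualProb (z : ShiftSpace E) (n : ℕ) :
    (ruelleDualProb p f z n : Measure (ShiftSpace E))
      = (ruelleDualIter p f z n Set.univ)⁻¹ • ruelleDualIter p f z n := rfl

theorem integral_ruelleDualProb (z : ShiftSpace E) (n : ℕ) (φ : ShiftSpace E →ᵇ ℝ) :
    ∫ x, φ x ∂(ruelleDualProb p f z n : Measure (ShiftSpace E))
      = (ruelleEnd p f ^ n) φ z / (ruelleEnd p f ^ n) 1 z := by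
  have h := integral_ruelleDualIter p f z n 1
  rw [coe_ruelleDualProb, integral_smul_measure, integral_ruelleDualIter, ← h]
  simp [div_eq_inv_mul, Measure.real]

theorem ruelleDualProb_coord_le {z : ShiftSpace E} {B : Set E} (hB : MeasurableSet B)
    (hz : ∀ i, z i ∉ B) (n i : ℕ) :
    (ruelleDualProb p f z n : Measure (ShiftSpace E)) {x | x i ∈ B}
      ≤ ENNReal.ofReal (Real.exp ‖f‖) ^ (2 * (i + 1)) * p B := by
  have h0 := ruelleDualIter_univ_ne_zero p f z n
  have h1 : ruelleDualIter p f z n Set.univ ≠ ∞ := measure_ne_top _ _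
  rw [coe_ruelleDualProb, Measure.smul_apply, smul_eq_mul]
  refine (mul_le_mul_right (ruelleDualIter_coord_le p f hB hz n i) _).trans_eq ?_
  rw [mul_left_comm, ENNReal.inv_mul_cancel h0 h1, mul_one]

theorem isTightMeasureSet_ruelleDualProb [CompleteSpace E] (a : E) :
    IsTightMeasureSet {((μ : ProbabilityMeasure (ShiftSpace E)) : Measure (ShiftSpace E)) |
      μ ∈ Set.range (ruelleDualProb p f (ofPi fun _ => a))} := by
  rw [isTightMeasureSet_iff_exists_isCompact_measure_compl_le]
  intro ε hε
  set c := ENNReal.ofReal (Real.exp ‖f‖)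
  have hc0 : c ≠ 0 := (ENNReal.ofReal_pos.2 (Real.exp_pos _)).ne'
  have hcT : c ≠ ∞ := ENNReal.ofReal_ne_top
  obtain ⟨δ, hδ0, hδ⟩ := ENNReal.exists_pos_sum_of_countable hε.ne' ℕ
  have hp := isTightMeasureSet_iff_exists_isCompact_measure_compl_le.1
    (isTightMeasureSet_singleton (μ := p))
  -- The tolerance for coordinate `i` cancels the factor `c ^ (2 (i + 1))`, leaving the summable `δ
  -- i`.
  have hK : ∀ i : ℕ, ∃ K : Set E, IsCompact K ∧ p Kᶜ ≤ (c ^ (2 * (i + 1)))⁻¹ * δ i := fun i => by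
    obtain ⟨K, hK, h⟩ := hp ((c ^ (2 * (i + 1)))⁻¹ * δ i)
      (ENNReal.mul_pos (ENNReal.inv_ne_zero.2 (ENNReal.pow_ne_top hcT))
        (ENNReal.coe_ne_zero.2 (hδ0 i).ne'))
    exact ⟨K, hK, h p rfl⟩
  choose K hKc hKp using hK
  -- Inserting `a` keeps the constant starting sequence inside the box.
  refine ⟨{x | ∀ i, x i ∈ insert a (K i)}, isCompact_pi fun i => (hKc i).insert a, ?_⟩
  rintro _ ⟨_, ⟨n, rfl⟩, rfl⟩
  have e : {x : ShiftSpace E | ∀ i, x i ∈ insert a (K i)}ᶜ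
      = ⋃ i, {x : ShiftSpace E | x i ∈ (insert a (K i))ᶜ} := by
    ext x; simp
  rw [e]
  refine (measure_iUnion_le _).trans ((ENNReal.tsum_le_tsum fun i => ?_).trans hδ.le)
  refine (ruelleDualProb_coord_le p f ((hKc i).insert a).measurableSet.compl
    (fun j h => h (Set.mem_insert a _)) n i).trans ?_
  calc _ ≤ c ^ (2 * (i + 1)) * ((c ^ (2 * (i + 1)))⁻¹ * δ i) := by
        gcongr
        exact (measure_mono (Set.compl_subset_compl.2 (Set.subset_insert a _))).trans (hKp i)
    _ = δ i := ENNReal.mul_inv_cancel_left (pow_ne_zero _ hc0) (ENNReal.pow_ne_top hcT)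

end Dual

/-! ### Conformal measure and convergence to the eigenfunction -/

section Existence

variable [SecondCountableTopology E] [CompleteSpace E] {p : Measure E} [IsProbabilityMeasure p]
  {f : ShiftSpace E →ᵇ ℝ} {α : ℝ≥0} {D K : ℝ}

omit [SecondCountableTopology E] [CompleteSpace E] in
/-- Consecutive averages differ by at most the oscillation of the quotient. -/
theorem abs_ruelleEnd_div_sub_le {v w : ShiftSpace E →ᵇ ℝ} (hw : ∀ x, 0 < w x) {ε : ℝ}
    (h : ∀ x y, |v x / w x - v y / w y| ≤ ε) (z : ShiftSpace E) :
    |ruelleEnd p f v z / ruelleEnd p f w z - v z / w z| ≤ ε := by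
  have hLw := ruelleEnd_pos p f hw z
  have h1 := ruelleEnd_mono p f (φ := v) (ψ := (v z / w z + ε) • w) (fun x => by
    rw [bcf_smul_apply, ← div_le_iff₀ (hw x)]
    have := (abs_le.1 (h x z)).2
    linarith) z
  have h2 := ruelleEnd_mono p f (φ := (v z / w z - ε) • w) (ψ := v) (fun x => by
    rw [bcf_smul_apply, ← le_div_iff₀ (hw x)]
    have := (abs_le.1 (h x z)).1
    linarith) z
  rw [map_smul, bcf_smul_apply] at h1 h2
  rw [← div_le_iff₀ hLw] at h1
  rw [← le_div_iff₀ hLw] at h2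
  rw [abs_le]
  constructor <;> linarith

theorem exists_conformal (hα : 0 < α) (hα1 : α ≤ 1)
    (hf : ∀ x y, |f x - f y| ≤ D * dist x y ^ (α : ℝ)) (hK0 : 0 < K)
    (hK : (D + K) * (1 / 2 : ℝ) ^ (α : ℝ) ≤ K) :
    ∃ (ν : Measure (ShiftSpace E)) (lam : ℝ), IsProbabilityMeasure ν ∧ 0 < lam ∧
      ∀ φ : ShiftSpace E →ᵇ ℝ, ∫ x, ruelle p f φ x ∂ν = lam * ∫ x, φ x ∂ν := by
  obtain ⟨C, r, hC, hr0, hr1, hCr⟩ := exists_ruelleEnd_pow_div_abs_sub_le p hα hf hK0 hK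
  obtain ⟨a⟩ : Nonempty E := nonempty_of_isProbabilityMeasure p
  set z : ShiftSpace E := ofPi fun _ => a
  -- Prokhorov compactness gives a limit along a free ultrafilter, so no subsequence has to be
  -- tracked.
  obtain ⟨ν, -, hν⟩ := (isCompact_closure_of_isTightMeasureSet
    (isTightMeasureSet_ruelleDualProb p f a)).ultrafilter_le_nhds'
      (Ultrafilter.map (ruelleDualProb p f z) (hyperfilter ℕ))
      (Ultrafilter.mem_map.2 (Filter.univ_mem' fun n => subset_closure ⟨n, rfl⟩))
  have hlim : ∀ φ : ShiftSpace E →ᵇ ℝ,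
      Tendsto (fun n => (ruelleEnd p f ^ n) φ z / (ruelleEnd p f ^ n) 1 z)
        (hyperfilter ℕ) (𝓝 (∫ x, φ x ∂(ν : Measure (ShiftSpace E)))) := fun φ => by
    have h := ProbabilityMeasure.tendsto_iff_forall_integral_tendsto.1
      (show Tendsto (ruelleDualProb p f z) (hyperfilter ℕ) (𝓝 ν) from hν) φ
    simpa only [integral_ruelleDualProb] using h
  have h1pos : ∀ x, (0 : ℝ) < (1 : ShiftSpace E →ᵇ ℝ) x := fun _ => one_pos
  have hpos := ruelleEnd_pow_pos p f h1pos
  set lam := ∫ x, ruelleEnd p f 1 x ∂(ν : Measure (ShiftSpace E)) with hlam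
  have hlam0 : 0 < lam := by
    have h0 := ruelleEnd_pos p f h1pos
    rw [hlam, integral_pos_iff_support_of_nonneg (fun x => (h0 x).le)
      ((ruelleEnd p f 1).integrable _),
      show Function.support (ruelleEnd p f 1) = Set.univ from
        Set.eq_univ_of_forall fun x => (h0 x).ne', measure_univ]
    exact one_pos
  -- the eigenvalue equation on Hölder functions
  have hhol : ∀ (φ : ShiftSpace E →ᵇ ℝ) (B : ℝ), 0 ≤ B →
      (∀ x y, |φ x - φ y| ≤ B * dist x y ^ (α : ℝ)) →
      ∫ x, ruelle p f φ x ∂(ν : Measure (ShiftSpace E))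
        = lam * ∫ x, φ x ∂(ν : Measure (ShiftSpace E)) := fun φ B hB hφ => by
    have hdiff : Tendsto (fun n => (ruelleEnd p f ^ (n + 1)) φ z / (ruelleEnd p f ^ (n + 1)) 1 z
        - (ruelleEnd p f ^ n) φ z / (ruelleEnd p f ^ n) 1 z) atTop (𝓝 0) := by
      refine squeeze_zero_norm (a := fun n => C * r ^ n * B) (fun n => ?_) ?_
      · simp only [ruelleEnd_pow_succ]
        refine abs_ruelleEnd_div_sub_le (hpos n) (fun x y => ?_) z
        exact (hCr 1 φ (LogHolder.one hK0.le) h1pos B hB (by simpa using hφ) n x y).trans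
          (mul_le_of_le_one_right (by positivity) (dist_rpow_le_one x y α))
      · simpa using ((tendsto_pow_atTop_nhds_zero_of_lt_one hr0.le hr1).const_mul C).mul_const B
    have hnext : Tendsto
        (fun n => (ruelleEnd p f ^ (n + 1)) φ z / (ruelleEnd p f ^ (n + 1)) 1 z)
        (hyperfilter ℕ) (𝓝 (∫ x, φ x ∂(ν : Measure (ShiftSpace E)))) := by
      simpa using (hdiff.mono_left Nat.hyperfilter_le_atTop).add (hlim φ)
    -- Both sides are limits of `L^(n+1) φ z / L^n 1 z`, the second after factoring it as `(L^(n+1)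
    -- 1 / L^n 1) (L^(n+1) φ / L^(n+1) 1)`.
    refine tendsto_nhds_unique (hlim (ruelleEnd p f φ))
      (((hlim (ruelleEnd p f 1)).mul hnext).congr fun n => ?_)
    have h1 := (hpos n z).ne'
    have h2 := (hpos (n + 1) z).ne'
    rw [ruelleEnd_pow_succ'] at h2
    rw [ruelleEnd_pow_succ', ruelleEnd_pow_succ']
    field_simp
  -- Lipschitz functions are `α`-Hölder because distances and `α` are at most 1; they determine
  -- finite measures, which extends the eigenvalue equation to all bounded continuous functions.
  have hmeas : ruelleDual p f ν = lam.toNNReal • (ν : Measure (ShiftSpace E)) := by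
    refine ext_of_forall_lipschitz_integral_eq fun φ ⟨B, hB⟩ => ?_
    rw [integral_ruelleDual, integral_smul_nnreal_measure,
      hhol φ B B.coe_nonneg fun x y => ?_, NNReal.smul_def, Real.coe_toNNReal _ hlam0.le,
      smul_eq_mul]
    refine (hB.dist_le_mul x y).trans (mul_le_mul_of_nonneg_left ?_ B.coe_nonneg)
    have h := Real.rpow_le_rpow_of_exponent_ge' dist_nonneg (dist_le_one x y) α.coe_nonneg
      (NNReal.coe_le_one.2 hα1)
    rwa [Real.rpow_one] at h
  refine ⟨ν, lam, inferInstance, hlam0, fun φ => ?_⟩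
  rw [← integral_ruelleDual, hmeas, integral_smul_nnreal_measure, NNReal.smul_def,
    Real.coe_toNNReal _ hlam0.le, smul_eq_mul]

theorem exists_isPFRData (hα : 0 < α) (hα1 : α ≤ 1)
    (hf : ∀ x y, |f x - f y| ≤ D * dist x y ^ (α : ℝ)) (hK0 : 0 < K)
    (hK : (D + K) * (1 / 2 : ℝ) ^ (α : ℝ) ≤ K) :
    ∃ (ν : Measure (ShiftSpace E)) (lam : ℝ) (h : ShiftSpace E → ℝ), IsPFRData p f ν lam h := by
  obtain ⟨C, r, hC, hr0, hr1, hCr⟩ := exists_ruelleEnd_pow_div_abs_sub_le p hα hf hK0 hK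
  obtain ⟨ν, lam, hν1, hlam, hν⟩ := exists_conformal (p := p) hα hα1 hf hK0 hK
  have h1pos : ∀ x, (0 : ℝ) < (1 : ShiftSpace E →ᵇ ℝ) x := fun _ => one_pos
  have hpos := ruelleEnd_pow_pos p f h1pos
  have h1log : LogHolder α K (1 : ShiftSpace E →ᵇ ℝ) := LogHolder.one hK0.le
  have hb := ruelleEnd_pow_one_div_bounds hlam hν hf hK0.le hK
  have hint : ∀ n, ∫ x, (ruelleEnd p f ^ n) 1 x ∂ν = lam ^ n := fun n => by
    rw [integral_ruelleEnd_pow hν]; simp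
  set B := ‖ruelleEnd p f 1‖ * Real.exp K * K
  have hB0 : 0 ≤ B := by positivity
  have hL1 : ∀ x y, |ruelleEnd p f 1 x - ruelleEnd p f 1 y| ≤ B * dist x y ^ (α : ℝ) :=
    (h1log.ruelleEnd (p := p) hf hK h1pos).abs_sub_le hK0.le (ruelleEnd_pos p f h1pos)
      fun x => (le_abs_self _).trans ((ruelleEnd p f 1).norm_coe_le_norm x)
  -- This ratio is `L^n (L 1) / L^n 1`, with oscillation at most `C r^n B`; its mean weighted by
  -- `L^n 1 dν` is `lam`.
  have hR : ∀ n x, |(ruelleEnd p f ^ (n + 1)) 1 x / (ruelleEnd p f ^ n) 1 x - lam|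
      ≤ C * r ^ n * B := fun n x => by
    have hmul : (fun x => (ruelleEnd p f ^ (n + 1)) 1 x / (ruelleEnd p f ^ n) 1 x
        * (ruelleEnd p f ^ n) 1 x) = (ruelleEnd p f ^ (n + 1)) 1 :=
      funext fun x => div_mul_cancel₀ _ (hpos n x).ne'
    refine abs_sub_le_of_integral_mul_eq (ν := ν)
      (g := fun x => (ruelleEnd p f ^ (n + 1)) 1 x / (ruelleEnd p f ^ n) 1 x)
      (((ruelleEnd p f ^ n) 1).integrable ν)
      (by rw [hmul]; exact ((ruelleEnd p f ^ (n + 1)) 1).integrable ν)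
      (fun x => (hpos n x).le) (by rw [hint]; positivity)
      (by rw [hmul, hint, hint, pow_succ']) (fun x y => ?_) x
    simp only [ruelleEnd_pow_succ']
    exact (hCr 1 (ruelleEnd p f 1) h1log h1pos B hB0 (by simpa using hL1) n x y).trans
      (mul_le_of_le_one_right (by positivity) (dist_rpow_le_one x y α))
  have hlim : ∀ x, ∃ l, Tendsto (fun n => (ruelleEnd p f ^ n) 1 x / lam ^ n) atTop (𝓝 l) :=
    fun x => by
    refine cauchySeq_tendsto_of_complete (cauchySeq_of_le_geometric r (Real.exp K * C * B / lam)
      hr1 fun n => ?_)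
    have h1 := (hpos n x).ne'
    have e : (ruelleEnd p f ^ (n + 1)) 1 x / lam ^ (n + 1) - (ruelleEnd p f ^ n) 1 x / lam ^ n
        = (ruelleEnd p f ^ n) 1 x / lam ^ n
          * ((ruelleEnd p f ^ (n + 1)) 1 x / (ruelleEnd p f ^ n) 1 x - lam) / lam := by
      rw [pow_succ lam n]
      field_simp
    rw [dist_comm, Real.dist_eq, e, abs_div, abs_of_pos hlam, abs_mul,
      abs_of_nonneg ((Real.exp_pos _).le.trans (hb n x).1), div_mul_eq_mul_div (_ * _ * _)]
    refine div_le_div_of_nonneg_right ?_ hlam.le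
    refine (mul_le_mul (hb n x).2 (hR n x) (abs_nonneg _) (Real.exp_pos _).le).trans_eq ?_
    ring
  choose h hh using hlim
  refine ⟨ν, lam, h, hν1, hlam, hν, fun x => ?_⟩
  simpa only [iterate_ruelle_one, hint] using hh x

end Existence

end


/-! ### Assembly of the proposition -/

theorem proposition3p2 {E : Type*} [MetricSpace E] [CompleteSpace E]
    [TopologicalSpace.SeparableSpace E] [MeasurableSpace E] [BorelSpace E]
    (p : Measure E) [IsProbabilityMeasure p] (α : ℝ≥0) (hα0 : 0 < α) (hα1 : α < 1)
    (f : Hol (ShiftSpace E) α) :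
    (∃ (ν : Measure (ShiftSpace E)) (lam : ℝ) (h : ShiftSpace E → ℝ), IsPFRData p f ν lam h) ∧
    ∀ (ν : Measure (ShiftSpace E)) (lam : ℝ) (h : ShiftSpace E → ℝ), IsPFRData p f ν lam h →
      ∃ Q P : Hol (ShiftSpace E) α →L[ℝ] Hol (ShiftSpace E) α,
        (∀ φ x, Q φ x = ruelle p f (fun y => h y * φ y) x / (lam * h x)) ∧
        (∀ φ x, P φ x = ∫ y, φ y * h y ∂ν) ∧
        P ∘L Q = P ∧ Q ∘L P = P ∧
        (∃ s : ℝ, 0 < s ∧ s < 1 ∧ IsDecayRate p f ν α s) ∧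
        (∀ s : ℝ, 0 < s → s < 1 → IsDecayRate p f ν α s →
          ∃ C : ℝ, 0 < C ∧ ∀ n : ℕ, ‖(Q - P) ^ n‖ ≤ C * s ^ n) ∧
        IsCompl (Hol.constants (ShiftSpace E) α) (LinearMap.ker P.toLinearMap) ∧
        IsClosed (Hol.constants (ShiftSpace E) α : Set (Hol (ShiftSpace E) α)) ∧
        IsClosed (LinearMap.ker P.toLinearMap : Set (Hol (ShiftSpace E) α)) ∧
        (∀ φ ∈ Hol.constants (ShiftSpace E) α,
          Q φ ∈ Hol.constants (ShiftSpace E) α ∧ P φ ∈ Hol.constants (ShiftSpace E) α) ∧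
        (∀ φ ∈ LinearMap.ker P.toLinearMap,
          Q φ ∈ LinearMap.ker P.toLinearMap ∧ P φ ∈ LinearMap.ker P.toLinearMap) ∧
        (∀ φ ∈ Hol.constants (ShiftSpace E) α, Q φ = φ ∧ P φ = φ) := by
  have : SecondCountableTopology E := UniformSpace.secondCountable_of_separable E
  have hf := f.abs_sub_le
  obtain ⟨K, hK0, hK⟩ := exists_distortion_constant
    (D := nnHolderNorm α (f : ShiftSpace E → ℝ)) (θ := (1 / 2 : ℝ) ^ (α : ℝ))
    (NNReal.coe_nonneg _) (by positivity)
    (Real.rpow_lt_one (by norm_num) (by norm_num) (NNReal.coe_pos.2 hα0))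
  refine ⟨exists_isPFRData hα0 hα1.le hf hK0 hK, fun ν lam h hp => ?_⟩
  obtain ⟨H, rfl, hH⟩ := hp.exists_isNormalizedEigenfunction hα0 hf hK0.le hK
  have := hp.isProbabilityMeasure
  obtain ⟨Q, hQ⟩ := hH.exists_normalizedOperator hα0 hf hK0 hK
  obtain ⟨P, hP⟩ := hH.exists_projection hα0
  have hPmem : ∀ φ, P φ ∈ Hol.constants (ShiftSpace E) α := fun φ => ⟨_, hP φ⟩
  have hQc : ∀ φ ∈ Hol.constants (ShiftSpace E) α, Q φ = φ := fun φ ⟨c, hc⟩ =>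
    hH.normalizedOperator_apply_of_const hQ hc
  have hPc : ∀ φ ∈ Hol.constants (ShiftSpace E) α, P φ = φ := fun φ ⟨c, hc⟩ => by
    ext x
    simp_rw [hP, hc]
    rw [integral_const_mul, hH.integral_eq_one, mul_one]
  have hPQ : P ∘L Q = P := by
    ext φ x
    rw [ContinuousLinearMap.comp_apply, hP, hP, hH.integral_normalizedOperator_mul hQ]
  have hQP : Q ∘L P = P := by
    ext φ x
    rw [ContinuousLinearMap.comp_apply, hQc _ (hPmem φ)]
  have hPP : P ∘L P = P := by
    ext φ x
    rw [ContinuousLinearMap.comp_apply, hPc _ (hPmem φ)]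
  refine ⟨Q, P, hQ, hP, hPQ, hQP, hH.exists_isDecayRate hα0 hf hK0 hK, fun s hs0 _ hs => ?_,
    ?_, ?_, P.isClosed_ker, fun φ hφ => ⟨?_, hPmem φ⟩, fun φ hφ => ?_,
    fun φ hφ => ⟨hQc φ hφ, hPc φ hφ⟩⟩
  · obtain ⟨C, hC, h⟩ := hH.norm_sub_le_of_isDecayRate hQ hP hs0 hs
    -- The added 1 covers `n = 0`, where the power is the identity rather than `Q^0 - P`.
    refine ⟨C + 1, by positivity, fun n => ?_⟩
    cases n with
    | zero =>
      rw [pow_zero, pow_zero, mul_one]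
      exact ContinuousLinearMap.norm_id_le.trans (by linarith)
    | succ n =>
      rw [sub_pow_succ_of_mul_eq hQP hPQ hPP]
      exact (h (n + 1)).trans (mul_le_mul_of_nonneg_right (by linarith) (by positivity))
  · refine isCompl_iff.2 ⟨Submodule.disjoint_def.2 fun φ hφ hker => ?_,
      codisjoint_iff_le_sup.2 fun φ _ => ?_⟩
    · rw [← hPc φ hφ]
      exact hker
    · refine Submodule.mem_sup.2 ⟨P φ, hPmem φ, φ - P φ, ?_, add_sub_cancel _ _⟩
      change P (φ - P φ) = 0
      rw [map_sub, hPc _ (hPmem φ), sub_self]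
  · have e : (Hol.constants (ShiftSpace E) α : Set (Hol (ShiftSpace E) α)) = {φ | P φ = φ} :=
      Set.ext fun φ => ⟨hPc φ, fun h => h ▸ hPmem φ⟩
    rw [e]
    exact isClosed_eq P.continuous continuous_id
  · rw [hQc φ hφ]
    exact hφ
  · have h1 : P φ = 0 := hφ
    have h2 : P (Q φ) = 0 := by rw [← ContinuousLinearMap.comp_apply, hPQ, h1]
    exact ⟨h2, by rw [h1]; exact Submodule.zero_mem _⟩
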